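/- Let $m\ge 1$ be an integer and let $\mathcal W^{m,2}=\mathcal W^{m,2}([0,1])$ be the space of functions $f:[0,1]\to\mathbb R$ such that $f,f',\dots,f^{(m-1)}$ are absolutely continuous and $\int_0^1 (f^{(m)})^2<\infty$. For $\lambda>0$ put $\|f\|_{m,\lambda}^2=\|f\|_2^2+\lambda\|f^{(m)}\|_2^2$, where $\|\cdot\|_2$ is the norm of $\mathcal L^2([0,1])$. Observe $Y_i=f_o(t_{in})+\epsilon_i$ $(i=1,\dots,n)$, where $f_o\in\mathcal W^{m,2}$, the design points $t_{in}\in[0,1]$ are non-random, and $\epsilon_1,\epsilon_2,\dots$ are independent and identically distributed. Assume: (B1) $\rho:\mathbb R\to\mathbb R$ is convex and differentiable everywhere, its derivative $\psi$ is Lipschitz, and for every $\eta>0$ there is $M_\eta$ such that $|\psi(tx)-\psi(sx)|\le M_\eta|t-s|$ for all $t>\eta$, $s>\eta$ and $x\in\mathbb R$. (B2) For every $\alpha>0$, $\mathbb E\{\psi(\epsilon_1/\alpha)\}=0$ and $\mathbb E\{\psi(\epsilon_1/\alpha+t)\}=\xi(\alpha)t+o(|t|)$ as $t\to0$, for some function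 $\xi$ with $0<\inf_{|\sigma-\alpha|\le\delta}\xi(\alpha)\le\sup_{|\sigma-\alpha|\le\delta}\xi(\alpha)<\infty$ for some $\delta>0$, where $\sigma>0$ is the constant in (B5). (B3) There is a constant $C$ such that for all $n\ge2$ and all $f\in\mathcal W^{1,2}([0,1])$, $\left|\frac1n\sum_{i=1}^n f(t_{in})-\int_0^1 f(t)\,dt\right|\le\frac{C}{n}\|f'\|_2$. (B4) $\mathbb E|\epsilon_1|^c<\infty$ for some $c>0$. (B5) The scale estimate $\widehat\sigma=\widehat\sigma_n$ satisfies $n^{1/2}(\widehat\sigma-\sigma)=O_P(1)$ for some $\sigma>0$. Let $\lambda=\lambda_n>0$ satisfy $\lambda\asymp n^{-\gamma}$ for some $\gamma\in(0,1)$. For responses $y\in\mathbb R^n$ and a scale $s>0$ call $f\in\mathcal W^{m,2}$ a scaled M-type smoothing spline if it minimizes $$\frac1n\sum_{i=1}^n\rho\left(\frac{y_i-f(t_{in})}{s}\right)+\lambda\int_0^1\{f^{(m)}(x)\}^2\,dx$$ over $\mathcal W^{m,2}$. Then there exist, for all $n\ge 1$, scaled M-type smoothing splines (one for every $y\in\mathbb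 R^n$ and every $s>0$) such that the resulting sequence of estimates $\widehat f_{n,\widehat\sigma}$, obtained with $y=(Y_1,\dots,Y_n)$ and $s=\widehat\sigma$, satisfies $$\|\widehat f_{n,\widehat\sigma}-f_o\|_{m,\lambda}^2=O_P\left(\lambda+(n\lambda^{1/2m})^{-1}\right).$$ -/

import Mathlib

open Set Filter Topology MeasureTheory ProbabilityTheory Asymptotics

namespace MSpline

noncomputable section

/-- The `j`-th derivative of `f` on `[0,1]` (one-sided at the end points). -/
def D (j : ℕ) (f : ℝ → ℝ) : ℝ → ℝ := iteratedDerivWithin j f (Icc (0 : ℝ) 1)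

/-- `f`, restricted to `[0,1]`, belongs to the Hilbert-Sobolev space `W^{m,2}([0,1])`, `m ≥ 1`:
it has `m - 1` continuous derivatives on `[0,1]`, the last of which is absolutely continuous
(the lower ones then are so too), and its `m`-th derivative, which exists almost everywhere,
is square integrable. Values of `f` outside `[0,1]` play no role. -/
structure IsSobolev (m : ℕ) (f : ℝ → ℝ) : Prop where
  contDiffOn : ContDiffOn ℝ ((m - 1 : ℕ) : WithTop ℕ∞) f (Icc (0 : ℝ) 1)
  absCont : AbsolutelyContinuousOnInterval (D (m - 1) f) 0 1
  memLp : MemLp (D m f) 2 (volume.restrict (Icc (0 : ℝ) 1))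

/-- The squared `L²([0,1])` norm. -/
def l2Sq (f : ℝ → ℝ) : ℝ := ∫ x in (0 : ℝ)..1, f x ^ 2

/-- The squared norm `‖f‖²_{m,lam} = ‖f‖₂² + lam ‖f^{(m)}‖₂²` of `W^{m,2}([0,1])`. -/
def sobolevSq (m : ℕ) (lam : ℝ) (f : ℝ → ℝ) : ℝ := l2Sq f + lam * l2Sq (D m f)

/-- The penalized objective function with loss `ρ`, smoothing parameter `lam`, design points `t`,
responses `y` and scale `s`. -/
def objective (m : ℕ) (ρ : ℝ → ℝ) (lam : ℝ) {n : ℕ} (t y : Fin n → ℝ) (s : ℝ)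
    (f : ℝ → ℝ) : ℝ :=
  1 / (n : ℝ) * ∑ i, ρ ((y i - f (t i)) / s) + lam * l2Sq (D m f)

/-- `f` is a (scaled) M-type smoothing spline: it minimizes the objective over `W^{m,2}([0,1])`. -/
def IsSmoothingSpline (m : ℕ) (ρ : ℝ → ℝ) (lam : ℝ) {n : ℕ} (t y : Fin n → ℝ) (s : ℝ)
    (f : ℝ → ℝ) : Prop :=
  IsSobolev m f ∧ ∀ g, IsSobolev m g → objective m ρ lam t y s f ≤ objective m ρ lam t y s g

/-- Quasi-uniformity of a triangular array of design points. -/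
def QuasiUniform (t : ∀ n : ℕ, Fin n → ℝ) : Prop :=
  ∃ C : ℝ, ∀ n : ℕ, 2 ≤ n → ∀ f : ℝ → ℝ, IsSobolev 1 f →
    |1 / (n : ℝ) * ∑ i, f (t n i) - ∫ x in (0 : ℝ)..1, f x| ≤ C / n * √(l2Sq (D 1 f))

/-- `X n = O_P(a n)` as `n → ∞`. The measure of a set that is not measurable is its outer
measure, so no measurability of `X n` is needed. -/
def IsBigOP {Ω : Type*} [MeasurableSpace Ω] (P : Measure Ω) (X : ℕ → Ω → ℝ) (a : ℕ → ℝ) : Prop :=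
  ∀ η : ℝ, 0 < η → ∃ M : ℝ, ∀ᶠ n in atTop, P {ω | M * a n < |X n ω|} ≤ ENNReal.ofReal η

/-- `ρ` is convex with everywhere existing Lipschitz derivative `ψ`, and `ψ` varies slowly in the
tails. -/
structure SmoothLoss (ρ ψ : ℝ → ℝ) : Prop where
  convex : ConvexOn ℝ univ ρ
  hasDeriv : ∀ x, HasDerivAt ρ (ψ x) x
  lipschitz : ∃ K, LipschitzWith K ψ
  slow : ∀ η : ℝ, 0 < η → ∃ M : ℝ, ∀ t s x : ℝ, η < t → η < s →
    |ψ (t * x) - ψ (s * x)| ≤ M * |t - s|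

/-- Mean zero score at every scale and a linearization of `E ψ(e/α + t)` at `t = 0`, with slope
bounded and bounded away from zero for `α` near `σ`. -/
def ScoreLinearization {Ω : Type*} [MeasurableSpace Ω] (P : Measure Ω) (ψ : ℝ → ℝ) (e : Ω → ℝ)
    (σ : ℝ) : Prop :=
  ∃ ξ : ℝ → ℝ,
    (∀ α : ℝ, 0 < α →
      ∫ ω, ψ (e ω / α) ∂P = 0 ∧
      (fun t : ℝ => ∫ ω, ψ (e ω / α + t) ∂P - ξ α * t) =o[𝓝 0] (fun t : ℝ => |t|)) ∧
    ∃ δ lo hi : ℝ, 0 < δ ∧ 0 < lo ∧ ∀ α : ℝ, |σ - α| ≤ δ → lo ≤ ξ α ∧ ξ α ≤ hi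

end

end MSpline

/-!
# Convergence rate of scaled M-type smoothing splines

The spline minimizes a convex objective, so it lies within distance `r` (in `‖·‖_{m,lam}`) of the
regression function `fo` as soon as the objective is larger at every `fo + g` with
`‖g‖_{m,lam} = r` than at `fo` (`IsSmoothingSpline.sobolevSq_sub_le`). With
`r² = R² (lam + (n lam^{1/2m})⁻¹)` and `R` large, this is shown to hold with high probability.

*Removing the estimated scale.* Because `ψ` varies slowly in the tails, the increments
`s (ρ((e - h)/s) - ρ(e/s))` at `s = σ` and at the estimated scale differ by `O(n^{-1/2}) |h|`
(`SmoothLoss.abs_scale_change_le`), so that it suffices to work at the fixed scale `σ`.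

*Expansion.* The increment of the loss at scale `σ` is a linear term `-ψ(e/σ) h` plus the
nonnegative `excess`. By convexity and the linearization of the mean score, the mean excess is at
least `κ h²` for small `h` (`SmoothLoss.exists_le_integral_excess`); together with the penalty and
quasi-uniformity of the design (`QuasiUniform.exists_abs_sub_le`) this gives a term of order `r²`.
`objective_lt_of_sphere` collects the deterministic estimates.

*Fluctuations.* By the interpolation inequality `exists_sq_le_sobolevSq`, evaluation at a point is
bounded by `C lam^{-1/4m} ‖·‖_{m,lam}` and has a representer in the Hilbert space
`L² × L²` with that norm. Orthogonality of independent centred scores then bounds the linear term by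
`O_P((n lam^{1/2m})^{-1/2}) ‖g‖` uniformly in `g` (`measure_exists_linear_gt_le`). The centred
excess process over the ball is handled by symmetrization and contraction, in the form of an
induction on the number of observations that never introduces Rademacher variables
(`integral_finMax_process_le`): the excess is Lipschitz in `h` with a constant proportional to
`sup |g| → 0`, which makes its deviations of smaller order than `r²`
(`measure_exists_excess_deviation_le`).

*Existence.* Since the score takes both signs, `ρ` grows at least linearly. The objective depends on
finitely many values of `f` and on `‖f^{(m)}‖`, and the values are those of a Taylor polynomial plus
inner products of `f^{(m)}` with kernels; projecting `f^{(m)}` onto the span of the kernels reduces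
the problem to a coercive continuous function on a finite-dimensional space
(`exists_isSmoothingSpline`).
-/

namespace MSpline

/-! ### Functions on the unit interval -/

/-- Lebesgue measure on `[0,1]`. -/
noncomputable abbrev unitMeasure : Measure ℝ := volume.restrict (Icc (0 : ℝ) 1)

lemma uniqueDiffOn_unit : UniqueDiffOn ℝ (Icc (0 : ℝ) 1) := uniqueDiffOn_Icc one_pos

lemma D_zero (f : ℝ → ℝ) : D 0 f = f := iteratedDerivWithin_zero

lemma D_succ (j : ℕ) (f : ℝ → ℝ) : D (j + 1) f = derivWithin (D j f) (Icc (0 : ℝ) 1) :=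
  iteratedDerivWithin_succ

lemma ae_mem_Ioo : ∀ᵐ x ∂unitMeasure, x ∈ Ioo (0 : ℝ) 1 := by
  have h : unitMeasure = volume.restrict (Ioo (0 : ℝ) 1) :=
    (Measure.restrict_congr_set Ioo_ae_eq_Icc).symm
  rw [h]
  exact ae_restrict_mem measurableSet_Ioo

lemma ae_differentiableAt_of_absCont {F : ℝ → ℝ} (hF : AbsolutelyContinuousOnInterval F 0 1) :
    ∀ᵐ x ∂unitMeasure, DifferentiableAt ℝ F x := by
  have h := hF.ae_differentiableAt
  rw [uIcc_of_le zero_le_one] at h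
  exact (ae_restrict_iff' measurableSet_Icc).2 h

lemma derivWithin_eq_deriv_of_mem_Ioo (F : ℝ → ℝ) {x : ℝ} (hx : x ∈ Ioo (0 : ℝ) 1) :
    derivWithin F (Icc 0 1) x = deriv F x :=
  derivWithin_of_mem_nhds (Icc_mem_nhds hx.1 hx.2)

lemma derivWithin_ae_eq_deriv (F : ℝ → ℝ) :
    derivWithin F (Icc 0 1) =ᵐ[unitMeasure] deriv F := by
  filter_upwards [ae_mem_Ioo] with x hx using derivWithin_eq_deriv_of_mem_Ioo F hx

lemma intervalIntegrable_of_integrable_unit {F : ℝ → ℝ} (hF : Integrable F unitMeasure) {x y : ℝ}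
    (hx : x ∈ Icc (0 : ℝ) 1) (hy : y ∈ Icc (0 : ℝ) 1) : IntervalIntegrable F volume x y := by
  have h : IntegrableOn F (uIcc x y) :=
    IntegrableOn.mono_set hF (OrdConnected.uIcc_subset ordConnected_Icc hx hy)
  exact h.intervalIntegrable

lemma integrable_derivWithin {F : ℝ → ℝ} (hF : AbsolutelyContinuousOnInterval F 0 1) :
    Integrable (derivWithin F (Icc 0 1)) unitMeasure := by
  refine Integrable.congr ?_ (derivWithin_ae_eq_deriv F).symm
  have := hF.intervalIntegrable_deriv
  rw [intervalIntegrable_iff_integrableOn_Icc_of_le zero_le_one] at this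
  exact this

lemma integral_derivWithin {F : ℝ → ℝ} (hF : AbsolutelyContinuousOnInterval F 0 1) {x y : ℝ}
    (hx : x ∈ Icc (0 : ℝ) 1) (hy : y ∈ Icc (0 : ℝ) 1) :
    ∫ z in x..y, derivWithin F (Icc 0 1) z = F y - F x := by
  have hsub : uIcc x y ⊆ uIcc 0 1 := by
    rw [uIcc_of_le (zero_le_one (α := ℝ))]
    exact OrdConnected.uIcc_subset ordConnected_Icc hx hy
  rw [← (hF.mono hsub).integral_deriv_eq_sub]
  apply intervalIntegral.integral_congr_ae
  have h := (ae_restrict_iff' measurableSet_Icc).1 (derivWithin_ae_eq_deriv F)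
  filter_upwards [h] with z hz hzm
  apply hz
  have := hsub (uIoc_subset_uIcc hzm)
  rwa [uIcc_of_le zero_le_one] at this

lemma IsSobolev.absCont_D {m : ℕ} {f : ℝ → ℝ} (hf : IsSobolev m f) {j : ℕ} (hj : j < m) :
    AbsolutelyContinuousOnInterval (D j f) 0 1 := by
  obtain ⟨k, rfl⟩ : ∃ k, m = k + 1 := ⟨m - 1, by omega⟩
  rcases (Nat.lt_succ_iff.1 hj).eq_or_lt with rfl | h
  · exact hf.absCont
  · have h1 : ContDiffOn ℝ ((j + 1 : ℕ) : WithTop ℕ∞) f (Icc 0 1) := by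
      refine hf.contDiffOn.of_le ?_
      simp only [Nat.add_sub_cancel]
      exact_mod_cast h
    have h2 := ((contDiffOn_nat_succ_iff_contDiffOn_one_iteratedDerivWithin
      uniqueDiffOn_unit).1 h1).2
    apply ContDiffOn.absolutelyContinuousOnInterval
    rw [uIcc_of_le zero_le_one]
    exact h2

lemma IsSobolev.integrable_D {m : ℕ} {f : ℝ → ℝ} (hf : IsSobolev m f) {j : ℕ} (hj : j < m) :
    Integrable (D (j + 1) f) unitMeasure := by
  rw [D_succ]
  exact integrable_derivWithin (hf.absCont_D hj)

lemma IsSobolev.integral_D {m : ℕ} {f : ℝ → ℝ} (hf : IsSobolev m f) {j : ℕ} (hj : j < m)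
    {x y : ℝ} (hx : x ∈ Icc (0 : ℝ) 1) (hy : y ∈ Icc (0 : ℝ) 1) :
    ∫ z in x..y, D (j + 1) f z = D j f y - D j f x := by
  rw [D_succ]
  exact integral_derivWithin (hf.absCont_D hj) hx hy

lemma IsSobolev.contDiffWithinAt {m : ℕ} {f : ℝ → ℝ} (hf : IsSobolev m f) {j : ℕ} (hj : j < m)
    {x : ℝ} (hx : x ∈ Icc (0 : ℝ) 1) : ContDiffWithinAt ℝ (j : WithTop ℕ∞) f (Icc 0 1) x := by
  refine (hf.contDiffOn x hx).of_le ?_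
  exact_mod_cast (by omega : j ≤ m - 1)

lemma IsSobolev.continuousOn {m : ℕ} {f : ℝ → ℝ} (hf : IsSobolev m f) :
    ContinuousOn f (Icc 0 1) := hf.contDiffOn.continuousOn

lemma memLp_of_continuousOn {f : ℝ → ℝ} (hf : ContinuousOn f (Icc 0 1)) :
    MemLp f 2 unitMeasure := by
  obtain ⟨C, hC⟩ := isCompact_Icc.exists_bound_of_continuousOn hf
  refine MemLp.of_bound (hf.aestronglyMeasurable measurableSet_Icc) C ?_
  exact (ae_restrict_iff' measurableSet_Icc).2 (Eventually.of_forall hC)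

lemma IsSobolev.memLp_self {m : ℕ} {f : ℝ → ℝ} (hf : IsSobolev m f) : MemLp f 2 unitMeasure :=
  memLp_of_continuousOn hf.continuousOn

/-! ### Linear structure -/

lemma D_add_eqOn {m : ℕ} {f g : ℝ → ℝ} (hf : IsSobolev m f) (hg : IsSobolev m g) {j : ℕ}
    (hj : j < m) : EqOn (D j (f + g)) (D j f + D j g) (Icc 0 1) := fun _ hx =>
  iteratedDerivWithin_add hx uniqueDiffOn_unit (hf.contDiffWithinAt hj hx)
    (hg.contDiffWithinAt hj hx)

/-- Absolute continuity on `[0,1]` depends only on the values there. -/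
lemma absCont_congr {F G : ℝ → ℝ} (hF : AbsolutelyContinuousOnInterval F 0 1)
    (h : EqOn G F (Icc 0 1)) : AbsolutelyContinuousOnInterval G 0 1 := by
  rw [absolutelyContinuousOnInterval_iff] at hF ⊢
  intro ε hε
  obtain ⟨δ, hδ, H⟩ := hF ε hε
  refine ⟨δ, hδ, fun E hE hEδ => ?_⟩
  refine lt_of_eq_of_lt (Finset.sum_congr rfl fun i hi => ?_) (H E hE hEδ)
  have hm := hE.1 i hi
  rw [uIcc_of_le (zero_le_one (α := ℝ))] at hm
  rw [h hm.1, h hm.2]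

lemma D_top_add_ae {m : ℕ} (hm : 1 ≤ m) {f g : ℝ → ℝ} (hf : IsSobolev m f) (hg : IsSobolev m g) :
    D m (f + g) =ᵐ[unitMeasure] D m f + D m g := by
  obtain ⟨k, rfl⟩ : ∃ k, m = k + 1 := ⟨m - 1, by omega⟩
  have hk : k < k + 1 := Nat.lt_succ_self k
  filter_upwards [ae_mem_Ioo, ae_differentiableAt_of_absCont (hf.absCont_D hk),
    ae_differentiableAt_of_absCont (hg.absCont_D hk)] with x hx hfx hgx
  have hx' := Ioo_subset_Icc_self hx
  have h := D_add_eqOn hf hg hk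
  rw [D_succ, derivWithin_congr h (h hx'), Pi.add_apply, D_succ, D_succ]
  exact derivWithin_add hfx.differentiableWithinAt hgx.differentiableWithinAt

lemma D_smul (j : ℕ) (c : ℝ) (f : ℝ → ℝ) : D j (c • f) = c • D j f := by
  ext x
  exact iteratedDerivWithin_const_smul_field c f

lemma IsSobolev.add {m : ℕ} (hm : 1 ≤ m) {f g : ℝ → ℝ} (hf : IsSobolev m f)
    (hg : IsSobolev m g) : IsSobolev m (f + g) where
  contDiffOn := hf.contDiffOn.add hg.contDiffOn
  absCont := absCont_congr (hf.absCont.add hg.absCont) (D_add_eqOn hf hg (by omega))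
  memLp := (hf.memLp.add hg.memLp).ae_eq (D_top_add_ae hm hf hg).symm

lemma IsSobolev.smul {m : ℕ} {f : ℝ → ℝ} (hf : IsSobolev m f) (c : ℝ) :
    IsSobolev m (c • f) where
  contDiffOn := contDiffOn_const.smul hf.contDiffOn
  absCont := by rw [D_smul]; exact hf.absCont.const_smul c
  memLp := by rw [D_smul]; exact hf.memLp.const_smul c

lemma D_fun_zero (j : ℕ) : D j (0 : ℝ → ℝ) = 0 := by
  simpa using D_smul j 0 (0 : ℝ → ℝ)

lemma isSobolev_zero (m : ℕ) : IsSobolev m 0 where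
  contDiffOn := contDiffOn_const
  absCont := by
    rw [D_fun_zero]
    apply ContDiffOn.absolutelyContinuousOnInterval
    exact contDiffOn_const
  memLp := by rw [D_fun_zero]; exact MemLp.zero

/-- The vector space `W^{m,2}([0,1])`. -/
def sobolev (m : ℕ) (hm : 1 ≤ m) : Submodule ℝ (ℝ → ℝ) where
  carrier := {f | IsSobolev m f}
  add_mem' hf hg := IsSobolev.add hm hf hg
  zero_mem' := isSobolev_zero m
  smul_mem' c _ hf := IsSobolev.smul hf c

/-- The top derivative as a linear map `W^{m,2}([0,1]) → L²([0,1])`. -/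
noncomputable def topDeriv (m : ℕ) (hm : 1 ≤ m) : sobolev m hm →ₗ[ℝ] Lp ℝ 2 unitMeasure where
  toFun f := f.2.memLp.toLp
  map_add' f g := by
    rw [← MemLp.toLp_add, MemLp.toLp_eq_toLp_iff]
    exact D_top_add_ae hm f.2 g.2
  map_smul' c f := by
    rw [RingHom.id_apply, ← MemLp.toLp_const_smul, MemLp.toLp_eq_toLp_iff]
    exact Eventually.of_forall fun x => congrFun (D_smul m c f) x

/-- The inclusion `W^{m,2}([0,1]) → L²([0,1])`. -/
noncomputable def inclL2 (m : ℕ) (hm : 1 ≤ m) : sobolev m hm →ₗ[ℝ] Lp ℝ 2 unitMeasure where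
  toFun f := (IsSobolev.memLp_self f.2).toLp
  map_add' f g := by
    rw [← MemLp.toLp_add, MemLp.toLp_eq_toLp_iff]
    exact Eventually.of_forall fun x => rfl
  map_smul' c f := by
    rw [RingHom.id_apply, ← MemLp.toLp_const_smul, MemLp.toLp_eq_toLp_iff]
    exact Eventually.of_forall fun x => rfl

lemma l2Sq_eq_setIntegral (f : ℝ → ℝ) : l2Sq f = ∫ x, f x ^ 2 ∂unitMeasure := by
  rw [l2Sq, intervalIntegral.integral_of_le zero_le_one, integral_Icc_eq_integral_Ioc]

lemma l2Sq_nonneg (f : ℝ → ℝ) : 0 ≤ l2Sq f := by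
  rw [l2Sq_eq_setIntegral]
  exact integral_nonneg fun x => sq_nonneg _

lemma l2Sq_eq_norm_toLp {f : ℝ → ℝ} (hf : MemLp f 2 unitMeasure) : l2Sq f = ‖hf.toLp‖ ^ 2 := by
  rw [← real_inner_self_eq_norm_sq, L2.inner_def, l2Sq_eq_setIntegral]
  refine integral_congr_ae ?_
  filter_upwards [hf.coeFn_toLp] with x hx
  rw [hx]
  simp [pow_two]

lemma l2Sq_congr_ae {f g : ℝ → ℝ} (h : f =ᵐ[unitMeasure] g) : l2Sq f = l2Sq g := by
  rw [l2Sq_eq_setIntegral, l2Sq_eq_setIntegral]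
  refine integral_congr_ae ?_
  filter_upwards [h] with x hx
  rw [hx]

lemma sobolevSq_nonneg (m : ℕ) {lam : ℝ} (hlam : 0 ≤ lam) (f : ℝ → ℝ) : 0 ≤ sobolevSq m lam f :=
  add_nonneg (l2Sq_nonneg _) (mul_nonneg hlam (l2Sq_nonneg _))

/-! ### Taylor expansion with an `L²` remainder -/

/-- The integral of `|u|` over a subinterval of `[0,1]` by Cauchy-Schwarz. -/
lemma abs_integral_abs_le {u : ℝ → ℝ} (hu : MemLp u 2 unitMeasure) {a x : ℝ}
    (ha : a ∈ Icc (0 : ℝ) 1) (hx : x ∈ Icc (0 : ℝ) 1) :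
    |(∫ z in a..x, |u z|)| ≤ √|x - a| * √(l2Sq u) := by
  have hsub : uIoc a x ⊆ Icc (0 : ℝ) 1 :=
    uIoc_subset_uIcc.trans (OrdConnected.uIcc_subset ordConnected_Icc ha hx)
  have h1 : |(∫ z in a..x, |u z|)| = ∫ z in uIoc a x, |u z| := by
    rw [intervalIntegral.abs_integral_eq_abs_integral_uIoc, abs_of_nonneg]
    exact integral_nonneg fun z => abs_nonneg _
  rw [h1, ← Real.sqrt_mul (abs_nonneg _)]
  apply Real.le_sqrt_of_sq_le
  have hu' : MemLp u 2 (volume.restrict (uIoc a x)) := hu.mono_measure (Measure.restrict_mono hsub le_rfl)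
  have hfin : IsFiniteMeasure (volume.restrict (uIoc a x)) := by
    constructor
    simp [uIoc]
  have h3 := integral_mul_le_Lp_mul_Lq_of_nonneg (μ := volume.restrict (uIoc a x))
    (f := fun _ => (1 : ℝ)) (g := fun z => |u z|) (Real.HolderConjugate.two_two)
    (Eventually.of_forall fun _ => zero_le_one) (Eventually.of_forall fun _ => abs_nonneg _)
    (by simpa using memLp_const (1 : ℝ)) (by simpa using hu'.norm)
  simp only [one_mul, Real.one_rpow] at h3
  have h4 : ∫ z in uIoc a x, |u z| ^ (2 : ℝ) = ∫ z in uIoc a x, u z ^ 2 := by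
    congr 1; ext z; simp
  have h5 : ∫ z in uIoc a x, u z ^ 2 ≤ l2Sq u := by
    rw [l2Sq_eq_setIntegral]
    exact setIntegral_mono_set hu.integrable_sq (Eventually.of_forall fun _ => sq_nonneg _)
      hsub.eventuallyLE
  have h6 : ∫ _ in uIoc a x, (1 : ℝ) = |x - a| := by simp [uIoc, Measure.real, Real.volume_Ioc, max_sub_min_eq_abs]
  rw [h4, h6] at h3
  calc (∫ z in uIoc a x, |u z|) ^ 2
      ≤ (|x - a| ^ (1 / 2 : ℝ) * (∫ z in uIoc a x, u z ^ 2) ^ (1 / 2 : ℝ)) ^ 2 :=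
        pow_le_pow_left₀ (integral_nonneg fun z => abs_nonneg _) h3 2
    _ = |x - a| * ∫ z in uIoc a x, u z ^ 2 := by
        rw [mul_pow, ← Real.sqrt_eq_rpow, ← Real.sqrt_eq_rpow, Real.sq_sqrt (abs_nonneg _),
          Real.sq_sqrt (integral_nonneg fun z => sq_nonneg _)]
    _ ≤ |x - a| * l2Sq u := mul_le_mul_of_nonneg_left h5 (abs_nonneg _)

/-- The functions `G 0, …, G k` are successive primitives on `[0,1]`. -/
def IsChain (k : ℕ) (G : ℕ → ℝ → ℝ) : Prop :=
  ∀ j < k, Integrable (G (j + 1)) unitMeasure ∧ ∀ x ∈ Icc (0 : ℝ) 1, ∀ y ∈ Icc (0 : ℝ) 1,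
    ∫ z in x..y, G (j + 1) z = G j y - G j x

lemma IsChain.taylor_bound {k : ℕ} {G : ℕ → ℝ → ℝ} (hG : IsChain (k + 1) G) {a x : ℝ}
    (ha : a ∈ Icc (0 : ℝ) 1) (hx : x ∈ Icc (0 : ℝ) 1) :
    |G 0 x - ∑ j ∈ Finset.range (k + 1), G j a * ((x - a) ^ j / j.factorial)| ≤
      |x - a| ^ k * |(∫ z in a..x, |G (k + 1) z|)| := by
  induction k generalizing G x with
  | zero =>
    simp only [zero_add, Finset.range_one, Finset.sum_singleton, pow_zero, Nat.factorial_zero,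
      Nat.cast_one, div_one, mul_one, one_mul]
    rw [← (hG 0 one_pos).2 a ha x hx]
    exact intervalIntegral.norm_integral_le_abs_integral_norm (f := G 1)
  | succ k ih =>
    have hG' : IsChain (k + 1) fun j => G (j + 1) := fun j hj => hG (j + 1) (by omega)
    have hxy : ∀ y ∈ uIoc a x, y ∈ Icc (0 : ℝ) 1 := fun y hy =>
      OrdConnected.uIcc_subset ordConnected_Icc ha hx (uIoc_subset_uIcc hy)
    have hint1 : IntervalIntegrable (G 1) volume a x :=
      intervalIntegrable_of_integrable_unit (hG 0 (by omega)).1 ha hx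
    have hintj : ∀ j ∈ Finset.range (k + 1), IntervalIntegrable
        (fun y : ℝ => G (j + 1) a * ((y - a) ^ j / j.factorial)) volume a x := fun j _ =>
      Continuous.intervalIntegrable (by fun_prop) _ _
    have key : G 0 x - ∑ j ∈ Finset.range (k + 1 + 1), G j a * ((x - a) ^ j / j.factorial) =
        ∫ y in a..x, (G 1 y -
          ∑ j ∈ Finset.range (k + 1), G (j + 1) a * ((y - a) ^ j / j.factorial)) := by
      rw [intervalIntegral.integral_sub hint1 (by
        simpa only [Finset.sum_fn] using IntervalIntegrable.sum (Finset.range (k + 1)) hintj),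
        (hG 0 (by omega)).2 a ha x hx, intervalIntegral.integral_finsetSum hintj,
        Finset.sum_range_succ']
      simp only [pow_zero, Nat.factorial_zero, Nat.cast_one, div_one, mul_one]
      rw [sub_sub, add_comm (G 0 a)]
      congr 2
      refine Finset.sum_congr rfl fun j _ => ?_
      rw [intervalIntegral.integral_const_mul, intervalIntegral.integral_div,
        intervalIntegral.integral_comp_sub_right (fun y => y ^ j) a, integral_pow,
        Nat.factorial_succ]
      have : (j.factorial : ℝ) ≠ 0 := by positivity
      push_cast
      field_simp
      simp
    rw [key]
    have hb : ∀ y ∈ uIoc a x, ‖G 1 y -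
        ∑ j ∈ Finset.range (k + 1), G (j + 1) a * ((y - a) ^ j / j.factorial)‖ ≤
        |x - a| ^ k * |(∫ z in a..x, |G (k + 1 + 1) z|)| := by
      intro y hy
      refine (ih hG' (hxy y hy)).trans ?_
      have hya : |y - a| ≤ |x - a| := by
        have := uIoc_subset_uIcc hy
        exact abs_sub_left_of_mem_uIcc this
      have hsub : uIoc a y ⊆ uIoc a x := by
        rcases le_total a x with h | h
        · rw [uIoc_of_le h] at hy ⊢
          rw [uIoc_of_le hy.1.le]
          exact Ioc_subset_Ioc_right hy.2
        · rw [uIoc_of_ge h] at hy ⊢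
          rw [uIoc_of_ge hy.2]
          exact Ioc_subset_Ioc_left hy.1.le
      have hmono := intervalIntegral.abs_integral_mono_interval (μ := volume)
        (f := fun z => |G (k + 1 + 1) z|) hsub (Eventually.of_forall fun _ => abs_nonneg _)
        (intervalIntegrable_of_integrable_unit (hG (k + 1) (by omega)).1 ha hx).abs
      gcongr
    refine (intervalIntegral.norm_integral_le_of_norm_le_const hb).trans (le_of_eq ?_)
    ring

lemma IsSobolev.isChain {m : ℕ} {f : ℝ → ℝ} (hf : IsSobolev m f) : IsChain m fun j => D j f :=
  fun _ hj => ⟨hf.integrable_D hj, fun _ hx _ hy => hf.integral_D hj hx hy⟩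

/-- Taylor's formula at `a`, with the remainder bounded by the `L²` norm of the top derivative. -/
lemma IsSobolev.taylor_bound {k : ℕ} {f : ℝ → ℝ} (hf : IsSobolev (k + 1) f) {a x : ℝ}
    (ha : a ∈ Icc (0 : ℝ) 1) (hx : x ∈ Icc (0 : ℝ) 1) :
    |f x - ∑ j ∈ Finset.range (k + 1), D j f a * ((x - a) ^ j / j.factorial)| ≤
      |x - a| ^ k * (√|x - a| * √(l2Sq (D (k + 1) f))) := by
  have h := hf.isChain.taylor_bound ha hx
  rw [D_zero] at h
  refine h.trans ?_
  gcongr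
  exact abs_integral_abs_le hf.memLp ha hx

/-! ### Interpolation inequalities -/

/-- The polynomial function `∑ c j y ^ j` as an element of `L²([0,1])`. -/
noncomputable def polyL2 (k : ℕ) : (Fin (k + 1) → ℝ) →ₗ[ℝ] Lp ℝ 2 unitMeasure where
  toFun c := (memLp_of_continuousOn (f := fun y : ℝ => ∑ j : Fin (k + 1), c j * y ^ (j : ℕ))
    (by fun_prop)).toLp
  map_add' c d := by
    rw [← MemLp.toLp_add, MemLp.toLp_eq_toLp_iff]
    exact Eventually.of_forall fun x => by simp [add_mul, Finset.sum_add_distrib]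
  map_smul' a c := by
    rw [RingHom.id_apply, ← MemLp.toLp_const_smul, MemLp.toLp_eq_toLp_iff]
    exact Eventually.of_forall fun x => by simp [Finset.mul_sum, mul_assoc]

lemma ker_polyL2 (k : ℕ) : LinearMap.ker (polyL2 k) = ⊥ := by
  rw [LinearMap.ker_eq_bot']
  intro c hc
  have h0 : (fun y : ℝ => ∑ j : Fin (k + 1), c j * y ^ (j : ℕ)) =ᵐ[unitMeasure] 0 := by
    have hm := memLp_of_continuousOn (f := fun y : ℝ => ∑ j : Fin (k + 1), c j * y ^ (j : ℕ))
      (by fun_prop)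
    exact hm.coeFn_toLp.symm.trans (by
      have : hm.toLp = 0 := hc
      rw [this]; exact Lp.coeFn_zero _ _ _)
  let p : Polynomial ℝ := ∑ j : Fin (k + 1), Polynomial.C (c j) * Polynomial.X ^ (j : ℕ)
  have hp : ∀ y, p.eval y = ∑ j : Fin (k + 1), c j * y ^ (j : ℕ) := fun y => by
    simp [p, Polynomial.eval_finsetSum]
  have hp0 : p = 0 := by
    apply Polynomial.eq_zero_of_infinite_isRoot
    intro hfin
    have hnull : volume {x | p.IsRoot x} = 0 := hfin.measure_zero _
    have h1 := (ae_restrict_iff' measurableSet_Icc).1 h0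
    have h2 : ∀ᵐ x : ℝ, x ∉ {x | p.IsRoot x} := measure_eq_zero_iff_ae_notMem.1 hnull
    have h3 : ∀ᵐ x : ℝ, x ∉ Icc (0 : ℝ) 1 := by
      filter_upwards [h1, h2] with x hx hx2 hx3
      exact hx2 (by simpa [Polynomial.IsRoot, hp] using hx hx3)
    have h4 := measure_eq_zero_iff_ae_notMem.2 h3
    simp at h4
  funext j
  have := congrArg (fun q => Polynomial.coeff q j) hp0
  simpa [p, Polynomial.finsetSum_coeff, Polynomial.coeff_C_mul, Polynomial.coeff_X_pow, Fin.val_inj]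
    using this

/-- Norm equivalence on polynomials: the coefficients are controlled by the `L²` norm. -/
lemma exists_coeff_sq_le (k : ℕ) : ∃ C : ℝ, 0 < C ∧ ∀ (c : Fin (k + 1) → ℝ) (j : Fin (k + 1)),
    c j ^ 2 ≤ C * l2Sq (fun y => ∑ j : Fin (k + 1), c j * y ^ (j : ℕ)) := by
  obtain ⟨K, hK, hanti⟩ := (polyL2 k).exists_antilipschitzWith (ker_polyL2 k)
  refine ⟨(K : ℝ) ^ 2, by positivity, fun c j => ?_⟩
  have h := hanti.le_mul_dist c 0
  rw [map_zero, dist_zero_right, dist_zero_right] at h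
  rw [l2Sq_eq_norm_toLp (memLp_of_continuousOn (by fun_prop)), ← mul_pow, ← sq_abs]
  exact pow_le_pow_left₀ (abs_nonneg _) ((norm_le_pi_norm c j).trans h) 2

lemma l2Sq_comp_affine_le {f : ℝ → ℝ} (hf : MemLp f 2 unitMeasure) {x h : ℝ} (hh : h ≠ 0)
    (hx : x ∈ Icc (0 : ℝ) 1) (hxh : x + h ∈ Icc (0 : ℝ) 1) :
    l2Sq (fun y => f (x + h * y)) ≤ |h|⁻¹ * l2Sq f := by
  have h1 := intervalIntegral.integral_comp_add_mul (a := 0) (b := 1) (fun z => f z ^ 2) hh x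
  simp only [mul_zero, add_zero, mul_one, smul_eq_mul] at h1
  rw [l2Sq, h1]
  have hsub : uIoc x (x + h) ⊆ Icc (0 : ℝ) 1 :=
    uIoc_subset_uIcc.trans (OrdConnected.uIcc_subset ordConnected_Icc hx hxh)
  have h5 : ∫ z in uIoc x (x + h), f z ^ 2 ≤ l2Sq f := by
    rw [l2Sq_eq_setIntegral]
    exact setIntegral_mono_set hf.integrable_sq (Eventually.of_forall fun _ => sq_nonneg _)
      hsub.eventuallyLE
  calc h⁻¹ * ∫ z in x..x + h, f z ^ 2
      ≤ |h⁻¹ * ∫ z in x..x + h, f z ^ 2| := le_abs_self _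
    _ = |h|⁻¹ * ∫ z in uIoc x (x + h), f z ^ 2 := by
      rw [abs_mul, abs_inv, intervalIntegral.abs_integral_eq_abs_integral_uIoc,
        abs_of_nonneg (integral_nonneg fun z => sq_nonneg _)]
    _ ≤ _ := by gcongr

/-- Interpolation at scale `h`: a derivative of order below the top one is controlled pointwise by
the `L²` norms of the function and of its top derivative. The Taylor polynomial on an interval of
length `h` is compared with the function, and its coefficients with its `L²` norm. -/
lemma exists_interpolation (k : ℕ) : ∃ C : ℝ, 0 < C ∧ ∀ f : ℝ → ℝ, IsSobolev (k + 1) f →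
    ∀ x ∈ Icc (0 : ℝ) 1, ∀ h : ℝ, 0 < h → h ≤ 1 / 2 → ∀ j ≤ k,
    D j f x ^ 2 * h ^ (2 * j + 1) ≤
      C * (l2Sq f + h ^ (2 * (k + 1)) * l2Sq (D (k + 1) f)) := by
  obtain ⟨C, hC, hcoeff⟩ := exists_coeff_sq_le k
  refine ⟨2 * C * (k.factorial : ℝ) ^ 2, by positivity, fun f hf x hx h0 hh0 hh2 j hj => ?_⟩
  obtain ⟨h, habs, hxh⟩ : ∃ h : ℝ, |h| = h0 ∧ x + h ∈ Icc (0 : ℝ) 1 := by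
    rcases le_total x (1 / 2) with hxx | hxx
    · exact ⟨h0, abs_of_pos hh0, by constructor <;> linarith [hx.1]⟩
    · exact ⟨-h0, by rw [abs_neg, abs_of_pos hh0], by constructor <;> linarith [hx.2]⟩
  have hhne : h ≠ 0 := by
    rintro rfl
    simp at habs
    linarith
  set c : Fin (k + 1) → ℝ := fun j => D j f x * h ^ (j : ℕ) / (j : ℕ).factorial with hc
  set P : ℝ → ℝ := fun y => ∑ j : Fin (k + 1), c j * y ^ (j : ℕ) with hP
  set S := l2Sq (D (k + 1) f)
  have hS : 0 ≤ S := l2Sq_nonneg _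
  have hmem : ∀ y ∈ Icc (0 : ℝ) 1, x + h * y ∈ Icc (0 : ℝ) 1 := fun y hy => by
    have := (convex_Icc (0 : ℝ) 1) hx hxh (sub_nonneg.2 hy.2) hy.1 (by ring)
    simp only [smul_eq_mul] at this
    convert this using 1
    ring
  have hrem : ∀ y ∈ Icc (0 : ℝ) 1, (f (x + h * y) - P y) ^ 2 ≤ h0 ^ (2 * k + 1) * S := by
    intro y hy
    have h1 := hf.taylor_bound hx (hmem y hy)
    have h2 : ∑ j ∈ Finset.range (k + 1), D j f x * ((x + h * y - x) ^ j / j.factorial) = P y := by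
      rw [hP, Finset.sum_range]
      refine Finset.sum_congr rfl fun j _ => ?_
      rw [hc, add_sub_cancel_left, mul_pow]
      ring
    rw [h2, add_sub_cancel_left] at h1
    have h3 : |h * y| ≤ h0 := by
      rw [abs_mul, habs, abs_of_nonneg hy.1]
      nlinarith [hy.2]
    have h4 : |f (x + h * y) - P y| ≤ h0 ^ k * (√h0 * √S) := by
      refine h1.trans ?_
      gcongr
    rw [← sq_abs]
    calc |f (x + h * y) - P y| ^ 2 ≤ (h0 ^ k * (√h0 * √S)) ^ 2 :=
          pow_le_pow_left₀ (abs_nonneg _) h4 2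
      _ = _ := by
          rw [mul_pow, mul_pow, Real.sq_sqrt hh0.le, Real.sq_sqrt hS]
          ring
  have hmaps : MapsTo (fun y => x + h * y) (Icc (0 : ℝ) 1) (Icc 0 1) := hmem
  have hfc : ContinuousOn (fun y => f (x + h * y)) (Icc 0 1) :=
    hf.continuousOn.comp (by fun_prop) hmaps
  have hPl : l2Sq P ≤ 2 * l2Sq (fun y => f (x + h * y)) + 2 * (h0 ^ (2 * k + 1) * S) := by
    have hPi : Integrable (fun y => P y ^ 2) unitMeasure :=
      (memLp_of_continuousOn (f := P) (by fun_prop)).integrable_sq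
    have hfi := (memLp_of_continuousOn hfc).integrable_sq
    rw [l2Sq_eq_setIntegral, l2Sq_eq_setIntegral]
    have h1 : ∫ y, (2 * f (x + h * y) ^ 2 + 2 * (h0 ^ (2 * k + 1) * S)) ∂unitMeasure =
        2 * ∫ y, f (x + h * y) ^ 2 ∂unitMeasure + 2 * (h0 ^ (2 * k + 1) * S) := by
      rw [integral_add (hfi.const_mul 2) (integrable_const _), integral_const_mul]
      simp
    rw [← h1]
    refine integral_mono_ae hPi ((hfi.const_mul 2).add (integrable_const _)) ?_
    refine (ae_restrict_iff' measurableSet_Icc).2 (Eventually.of_forall fun y hy => ?_)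
    have := hrem y hy
    have h5 : P y ^ 2 ≤ 2 * f (x + h * y) ^ 2 + 2 * (f (x + h * y) - P y) ^ 2 := by
      nlinarith [sq_nonneg (2 * f (x + h * y) - P y)]
    simp only
    linarith
  have haff := l2Sq_comp_affine_le hf.memLp_self hhne hx hxh
  rw [habs] at haff
  have hcj := hcoeff c ⟨j, by omega⟩
  have hcsq : c ⟨j, by omega⟩ ^ 2 = D j f x ^ 2 * h0 ^ (2 * j) / (j.factorial : ℝ) ^ 2 := by
    rw [hc, ← habs, pow_mul |h| 2 j, sq_abs]
    ring
  have hjk : (j.factorial : ℝ) ≤ k.factorial := by exact_mod_cast Nat.factorial_le hj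
  have hjp : (0 : ℝ) < j.factorial := by positivity
  have h1 : D j f x ^ 2 * h0 ^ (2 * j) ≤ (j.factorial : ℝ) ^ 2 * (C * l2Sq P) := by
    rw [hcsq, div_le_iff₀ (by positivity)] at hcj
    linarith
  have h2 : l2Sq P * h0 ≤ 2 * (l2Sq f + h0 ^ (2 * (k + 1)) * S) := by
    calc l2Sq P * h0 ≤ (2 * (h0⁻¹ * l2Sq f) + 2 * (h0 ^ (2 * k + 1) * S)) * h0 := by
          gcongr; linarith
      _ = _ := by field_simp; ring
  calc D j f x ^ 2 * h0 ^ (2 * j + 1) = (D j f x ^ 2 * h0 ^ (2 * j)) * h0 := by ring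
    _ ≤ ((j.factorial : ℝ) ^ 2 * (C * l2Sq P)) * h0 := by gcongr
    _ = (j.factorial : ℝ) ^ 2 * C * (l2Sq P * h0) := by ring
    _ ≤ (k.factorial : ℝ) ^ 2 * C * (2 * (l2Sq f + h0 ^ (2 * (k + 1)) * S)) := by
        have := l2Sq_nonneg P
        gcongr
    _ = _ := by ring

/-- The sup-norm is bounded by the norm `‖·‖_{m,lam}` with the constant `lam ^ (-1/(4m))`. -/
lemma exists_sq_le_sobolevSq {m : ℕ} (hm : 1 ≤ m) : ∃ C : ℝ, 0 < C ∧ ∀ lam : ℝ, 0 < lam →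
    lam ≤ (1 / 2) ^ (2 * m) → ∀ f, IsSobolev m f → ∀ x ∈ Icc (0 : ℝ) 1,
    f x ^ 2 ≤ C * (lam ^ (1 / (2 * (m : ℝ))))⁻¹ * sobolevSq m lam f := by
  obtain ⟨k, rfl⟩ : ∃ k, m = k + 1 := ⟨m - 1, by omega⟩
  obtain ⟨C, hC, H⟩ := exists_interpolation k
  refine ⟨C, hC, fun lam hlam hle f hf x hx => ?_⟩
  set h : ℝ := lam ^ (1 / (2 * ((k + 1 : ℕ) : ℝ))) with hh
  have hh0 : 0 < h := Real.rpow_pos_of_pos hlam _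
  have hpow : h ^ (2 * (k + 1)) = lam := by
    rw [hh, ← Real.rpow_natCast, ← Real.rpow_mul hlam.le]
    have : (1 / (2 * ((k + 1 : ℕ) : ℝ))) * ((2 * (k + 1) : ℕ) : ℝ) = 1 := by
      push_cast
      field_simp
    rw [this, Real.rpow_one]
  have hh2 : h ≤ 1 / 2 := by
    by_contra! hcon
    have := pow_lt_pow_left₀ hcon (by norm_num) (n := 2 * (k + 1)) (by omega)
    rw [hpow] at this
    linarith
  have := H f hf x hx h hh0 hh2 0 (Nat.zero_le _)
  rw [hpow, D_zero] at this
  rw [sobolevSq]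
  simp only [mul_zero, zero_add, pow_one] at this
  rw [mul_right_comm, ← div_eq_mul_inv, le_div_iff₀ hh0]
  exact this

lemma exists_l2Sq_D_one_le {m : ℕ} (hm : 1 ≤ m) : ∃ C : ℝ, 0 < C ∧ ∀ f, IsSobolev m f →
    l2Sq (D 1 f) ≤ C * (l2Sq f + l2Sq (D m f)) := by
  obtain ⟨k, rfl⟩ : ∃ k, m = k + 1 := ⟨m - 1, by omega⟩
  rcases Nat.eq_zero_or_pos k with rfl | hk
  · exact ⟨1, one_pos, fun f _ => by linarith [l2Sq_nonneg f]⟩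
  obtain ⟨C, hC, H⟩ := exists_interpolation k
  refine ⟨8 * C, by positivity, fun f hf => ?_⟩
  have hb : ∀ x ∈ Icc (0 : ℝ) 1, D 1 f x ^ 2 ≤ 8 * C * (l2Sq f + l2Sq (D (k + 1) f)) := by
    intro x hx
    have h1 := H f hf x hx (1 / 2) (by norm_num) le_rfl 1 hk
    have h2 : ((1 : ℝ) / 2) ^ (2 * (k + 1)) * l2Sq (D (k + 1) f) ≤ l2Sq (D (k + 1) f) :=
      mul_le_of_le_one_left (l2Sq_nonneg _) (pow_le_one₀ (by norm_num) (by norm_num))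
    have h3 := mul_le_mul_of_nonneg_left (add_le_add_right h2 (l2Sq f)) hC.le
    norm_num at h1 h3
    nlinarith
  have hc := (hf.absCont_D (j := 1) (by omega)).continuousOn
  rw [uIcc_of_le zero_le_one] at hc
  rw [l2Sq_eq_setIntegral]
  calc ∫ x, D 1 f x ^ 2 ∂unitMeasure
      ≤ ∫ _, 8 * C * (l2Sq f + l2Sq (D (k + 1) f)) ∂unitMeasure :=
        integral_mono_ae (memLp_of_continuousOn hc).integrable_sq (integrable_const _)
          ((ae_restrict_iff' measurableSet_Icc).2 (Eventually.of_forall hb))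
    _ = _ := by simp

/-! ### The design -/

/-- A bounded factor times an `L²` function. -/
lemma memLp_mul_of_continuousOn {f u : ℝ → ℝ} (hf : ContinuousOn f (Icc 0 1))
    (hu : MemLp u 2 unitMeasure) : MemLp (fun x => f x * u x) 2 unitMeasure := by
  obtain ⟨C, hC⟩ := isCompact_Icc.exists_bound_of_continuousOn hf
  refine MemLp.of_le_mul (c := C) hu
    ((hf.aestronglyMeasurable measurableSet_Icc).mul hu.aestronglyMeasurable) ?_
  refine (ae_restrict_iff' measurableSet_Icc).2 (Eventually.of_forall fun x hx => ?_)
  rw [norm_mul]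
  exact mul_le_mul_of_nonneg_right (hC x hx) (norm_nonneg _)

lemma IsSobolev.memLp_D_one {m : ℕ} (hm : 1 ≤ m) {f : ℝ → ℝ} (hf : IsSobolev m f) :
    MemLp (D 1 f) 2 unitMeasure := by
  rcases hm.eq_or_lt with rfl | hm
  · exact hf.memLp
  · have hc := (hf.absCont_D hm).continuousOn
    rw [uIcc_of_le zero_le_one] at hc
    exact memLp_of_continuousOn hc

lemma IsSobolev.absCont_self {m : ℕ} (hm : 1 ≤ m) {f : ℝ → ℝ} (hf : IsSobolev m f) :
    AbsolutelyContinuousOnInterval f 0 1 := by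
  have := hf.absCont_D (j := 0) hm
  rwa [D_zero] at this

lemma D_one_sq_ae {m : ℕ} (hm : 1 ≤ m) {f : ℝ → ℝ} (hf : IsSobolev m f) :
    D 1 (fun x => f x ^ 2) =ᵐ[unitMeasure] fun x => 2 * f x * D 1 f x := by
  filter_upwards [ae_mem_Ioo, ae_differentiableAt_of_absCont (hf.absCont_self hm)] with x hx hd
  rw [D_succ, D_succ, D_zero, D_zero, derivWithin_eq_deriv_of_mem_Ioo _ hx,
    derivWithin_eq_deriv_of_mem_Ioo _ hx]
  have := (hd.hasDerivAt.pow 2).deriv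
  simpa [Pi.pow_def] using this

lemma IsSobolev.sq {m : ℕ} (hm : 1 ≤ m) {f : ℝ → ℝ} (hf : IsSobolev m f) :
    IsSobolev 1 (fun x => f x ^ 2) where
  contDiffOn := by
    rw [Nat.sub_self, Nat.cast_zero, contDiffOn_zero]
    exact hf.continuousOn.pow 2
  absCont := by
    have := (hf.absCont_self hm).mul (hf.absCont_self hm)
    rw [Nat.sub_self, D_zero]
    refine absCont_congr this fun x _ => ?_
    simp [pow_two]
  memLp := by
    refine MemLp.ae_eq (D_one_sq_ae hm hf).symm ?_
    exact memLp_mul_of_continuousOn (continuousOn_const.mul hf.continuousOn) (hf.memLp_D_one hm)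

lemma l2Sq_D_one_sq_le {m : ℕ} (hm : 1 ≤ m) {f : ℝ → ℝ} (hf : IsSobolev m f) {b : ℝ}
    (hb : ∀ x ∈ Icc (0 : ℝ) 1, f x ^ 2 ≤ b) :
    l2Sq (D 1 fun x => f x ^ 2) ≤ 4 * b * l2Sq (D 1 f) := by
  rw [l2Sq_congr_ae (D_one_sq_ae hm hf), l2Sq_eq_setIntegral, l2Sq_eq_setIntegral,
    ← integral_const_mul]
  have h1 := memLp_mul_of_continuousOn (f := fun x => 2 * f x)
    (continuousOn_const.mul hf.continuousOn) (hf.memLp_D_one hm)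
  refine integral_mono_ae h1.integrable_sq ((hf.memLp_D_one hm).integrable_sq.const_mul _) ?_
  refine (ae_restrict_iff' measurableSet_Icc).2 (Eventually.of_forall fun x hx => ?_)
  have := mul_le_mul_of_nonneg_right (hb x hx) (sq_nonneg (D 1 f x))
  simp only
  nlinarith

/-- For a quasi-uniform design the empirical and the `L²` norm differ by little, relative to
`‖·‖_{m,lam}`. -/
lemma QuasiUniform.exists_abs_sub_le {t : ∀ n : ℕ, Fin n → ℝ} (ht : QuasiUniform t) {m : ℕ}
    (hm : 1 ≤ m) : ∃ C : ℝ, 0 ≤ C ∧ ∀ lam : ℝ, 0 < lam → lam ≤ (1 / 2) ^ (2 * m) →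
    ∀ n : ℕ, 2 ≤ n → ∀ f, IsSobolev m f →
    |1 / (n : ℝ) * ∑ i, f (t n i) ^ 2 - l2Sq f| ≤ C / (n * lam) * sobolevSq m lam f := by
  obtain ⟨C₀, h₀⟩ := ht
  obtain ⟨C₁, hC₁, h₁⟩ := exists_sq_le_sobolevSq hm
  obtain ⟨C₂, hC₂, h₂⟩ := exists_l2Sq_D_one_le hm
  refine ⟨|C₀| * √(4 * C₁ * C₂), by positivity, fun lam hlam hle n hn f hf => ?_⟩
  have hle1 : lam ≤ 1 := hle.trans (pow_le_one₀ (by norm_num) (by norm_num))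
  have hq := sobolevSq_nonneg m hlam.le f
  set q := sobolevSq m lam f with hqdef
  have hn0 : (0 : ℝ) < n := by exact_mod_cast (by omega : 0 < n)
  have hd : l2Sq (D 1 f) ≤ C₂ * (lam⁻¹ * q) := by
    refine (h₂ f hf).trans ?_
    gcongr
    rw [hqdef, sobolevSq, mul_add, inv_mul_cancel_left₀ hlam.ne']
    gcongr
    exact le_mul_of_one_le_left (l2Sq_nonneg _) ((one_le_inv₀ hlam).2 hle1)
  have hlam' : lam ≤ lam ^ (1 / (2 * (m : ℝ))) := by
    have hm' : (1 : ℝ) ≤ m := by exact_mod_cast hm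
    calc lam = lam ^ (1 : ℝ) := (Real.rpow_one _).symm
      _ ≤ _ := Real.rpow_le_rpow_of_exponent_ge hlam hle1 (by
        rw [div_le_one (by positivity)]; linarith)
  have hsup : ∀ x ∈ Icc (0 : ℝ) 1, f x ^ 2 ≤ C₁ * lam⁻¹ * q := fun x hx =>
    (h₁ lam hlam hle f hf x hx).trans (by gcongr)
  have hD := l2Sq_D_one_sq_le hm hf hsup
  refine (h₀ n hn _ (hf.sq hm)).trans ?_
  have hs : √(l2Sq (D 1 fun x => f x ^ 2)) ≤ √(4 * C₁ * C₂) * (lam⁻¹ * q) := by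
    rw [Real.sqrt_le_left (by positivity), mul_pow, Real.sq_sqrt (by positivity)]
    calc _ ≤ _ := hD
      _ ≤ 4 * (C₁ * lam⁻¹ * q) * (C₂ * (lam⁻¹ * q)) := by gcongr
      _ = _ := by ring
  calc C₀ / n * √(l2Sq (D 1 fun x => f x ^ 2))
      ≤ |C₀| / n * (√(4 * C₁ * C₂) * (lam⁻¹ * q)) := by
        gcongr
        exact le_abs_self _
    _ = _ := by field_simp

/-! ### Representing functionals -/

/-- A linear functional that is bounded in terms of a linear map `T` into a Hilbert space is
represented by a vector of that space: no completeness of the range of `T` is needed, by the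
Hahn-Banach theorem. -/
lemma exists_representer {E H : Type*} [AddCommGroup E] [Module ℝ E] [NormedAddCommGroup H]
    [InnerProductSpace ℝ H] [CompleteSpace H] (T : E →ₗ[ℝ] H) (l : E →ₗ[ℝ] ℝ) {b : ℝ}
    (hb : 0 ≤ b) (h : ∀ g, |l g| ≤ b * ‖T g‖) :
    ∃ R : H, ‖R‖ ≤ b ∧ ∀ g, inner ℝ R (T g) = l g := by
  obtain ⟨s, hs⟩ := T.rangeRestrict.exists_rightInverse_of_surjective T.range_rangeRestrict
  have hs' : ∀ v : LinearMap.range T, T (s v) = v := fun v =>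
    congrArg Subtype.val (LinearMap.congr_fun hs v)
  let l' : StrongDual ℝ (LinearMap.range T) := (l ∘ₗ s).mkContinuous b fun v => by
    have := h (s v)
    rw [hs'] at this
    simpa using this
  have hl' : ∀ g, l' ⟨T g, g, rfl⟩ = l g := fun g => by
    have h1 : T (s ⟨T g, g, rfl⟩ - g) = 0 := by rw [map_sub, hs', sub_self]
    have h2 := h (s ⟨T g, g, rfl⟩ - g)
    rw [h1, norm_zero, mul_zero, map_sub] at h2
    have h3 := abs_nonpos_iff.1 h2
    change l (s ⟨T g, g, rfl⟩) = l g
    linarith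
  obtain ⟨L, hL, hLn⟩ := exists_extension_norm_eq _ l'
  refine ⟨(InnerProductSpace.toDual ℝ H).symm L, ?_, fun g => ?_⟩
  · rw [LinearIsometryEquiv.norm_map, hLn]
    exact LinearMap.mkContinuous_norm_le _ hb _
  · rw [InnerProductSpace.toDual_symm_apply, ← hl' g]
    exact hL ⟨T g, g, rfl⟩

/-- The derivative of order `j < m` at a point as a linear functional on `W^{m,2}([0,1])`. -/
noncomputable def evalD (m : ℕ) (hm : 1 ≤ m) {j : ℕ} (hj : j < m) {x : ℝ}
    (hx : x ∈ Icc (0 : ℝ) 1) : sobolev m hm →ₗ[ℝ] ℝ where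
  toFun f := D j f x
  map_add' f g := D_add_eqOn f.2 g.2 hj hx
  map_smul' c f := congrFun (D_smul j c f) x

/-- Evaluation at a point. -/
noncomputable def evalPt (m : ℕ) (hm : 1 ≤ m) (x : ℝ) : sobolev m hm →ₗ[ℝ] ℝ :=
  (LinearMap.proj x : (ℝ → ℝ) →ₗ[ℝ] ℝ) ∘ₗ (sobolev m hm).subtype

/-- Function values are given by the initial derivatives at `0` and by an inner product with the
top derivative. -/
lemma exists_taylor_kernel (m : ℕ) (hm : 1 ≤ m) {x : ℝ} (hx : x ∈ Icc (0 : ℝ) 1) :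
    ∃ R : Lp ℝ 2 unitMeasure, ∀ f : sobolev m hm,
      (f : ℝ → ℝ) x = ∑ j : Fin m, D j f 0 * (x ^ (j : ℕ) / (j : ℕ).factorial) +
        inner ℝ R (topDeriv m hm f) := by
  have h0 : (0 : ℝ) ∈ Icc (0 : ℝ) 1 := ⟨le_rfl, zero_le_one⟩
  let l : sobolev m hm →ₗ[ℝ] ℝ := evalPt m hm x -
    ∑ j : Fin m, (x ^ (j : ℕ) / (j : ℕ).factorial) • evalD m hm j.2 h0
  have hl : ∀ f : sobolev m hm, l f =
      (f : ℝ → ℝ) x - ∑ j : Fin m, D j f 0 * (x ^ (j : ℕ) / (j : ℕ).factorial) := fun f => by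
    simp only [l, LinearMap.sub_apply, LinearMap.sum_apply, LinearMap.smul_apply, smul_eq_mul]
    congr 1
    exact Finset.sum_congr rfl fun j _ => mul_comm _ _
  have hb : ∀ f : sobolev m hm, |l f| ≤ 1 * ‖topDeriv m hm f‖ := fun f => by
    obtain ⟨k, rfl⟩ : ∃ k, m = k + 1 := ⟨m - 1, by omega⟩
    have h1 := IsSobolev.taylor_bound f.2 h0 hx
    rw [sub_zero, Finset.sum_range] at h1
    have h2 : √(l2Sq (D (k + 1) f)) = ‖topDeriv (k + 1) hm f‖ := by
      rw [l2Sq_eq_norm_toLp f.2.memLp]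
      exact Real.sqrt_sq (norm_nonneg _)
    have hx1 : |x| ≤ 1 := abs_le.2 ⟨by linarith [hx.1], hx.2⟩
    rw [hl, ← h2]
    refine h1.trans ?_
    have h3 : √|x| ≤ 1 := Real.sqrt_le_one.2 hx1
    have h4 : |x| ^ k ≤ 1 := pow_le_one₀ (abs_nonneg _) hx1
    calc |x| ^ k * (√|x| * √(l2Sq (D (k + 1) f))) ≤ 1 * (1 * √(l2Sq (D (k + 1) f))) := by gcongr
      _ = _ := by ring
  obtain ⟨R, -, hR⟩ := exists_representer (topDeriv m hm) l zero_le_one hb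
  refine ⟨R, fun f => ?_⟩
  rw [hR, hl]
  ring

/-! ### Iterated primitives -/

/-- The `k`-fold primitive of `u` on `[0,1]` with prescribed values `a i` at `0`. -/
noncomputable def iterPrim (a : ℕ → ℝ) (u : ℝ → ℝ) : ℕ → ℝ → ℝ
  | 0 => u
  | k + 1 => fun x => a k + ∫ z in (0 : ℝ)..x, iterPrim a u k z

lemma absCont_primitive {F : ℝ → ℝ} (hF : Integrable F unitMeasure) (c : ℝ) :
    AbsolutelyContinuousOnInterval (fun x => c + ∫ z in (0 : ℝ)..x, F z) 0 1 := by
  have h0 : (0 : ℝ) ∈ Icc (0 : ℝ) 1 := ⟨le_rfl, zero_le_one⟩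
  have h1 : (1 : ℝ) ∈ Icc (0 : ℝ) 1 := ⟨zero_le_one, le_rfl⟩
  have hc : AbsolutelyContinuousOnInterval (fun _ : ℝ => c) 0 1 :=
    ContDiffOn.absolutelyContinuousOnInterval contDiffOn_const
  exact hc.add ((intervalIntegrable_of_integrable_unit hF h0
    h1).absolutelyContinuousOnInterval_intervalIntegral (by simp))

lemma hasDerivWithinAt_primitive {F : ℝ → ℝ} (hF : ContinuousOn F (Icc 0 1)) (c : ℝ) {x : ℝ}
    (hx : x ∈ Icc (0 : ℝ) 1) :
    HasDerivWithinAt (fun x => c + ∫ z in (0 : ℝ)..x, F z) (F x) (Icc 0 1) x := by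
  have h0 : (0 : ℝ) ∈ Icc (0 : ℝ) 1 := ⟨le_rfl, zero_le_one⟩
  have : Fact (x ∈ Icc (0 : ℝ) 1) := ⟨hx⟩
  refine HasDerivWithinAt.const_add c ?_
  exact intervalIntegral.integral_hasDerivWithinAt_right
    (intervalIntegrable_of_integrable_unit ((memLp_of_continuousOn hF).integrable (by simp)) h0 hx)
    (hF.stronglyMeasurableAtFilter_nhdsWithin measurableSet_Icc x) (hF x hx)

section iterPrim

variable (a : ℕ → ℝ) {u : ℝ → ℝ}

lemma iterPrim_continuousOn (hu : Integrable u unitMeasure) (k : ℕ) :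
    ContinuousOn (iterPrim a u (k + 1)) (Icc 0 1) := by
  induction k with
  | zero =>
    have := (absCont_primitive hu (a 0)).continuousOn
    rwa [uIcc_of_le zero_le_one] at this
  | succ k ih =>
    have := (absCont_primitive ((memLp_of_continuousOn ih).integrable (by simp))
      (a (k + 1))).continuousOn
    rwa [uIcc_of_le zero_le_one] at this

lemma D_iterPrim (hu : Integrable u unitMeasure) {k j : ℕ} (hj : j ≤ k) :
    EqOn (D j (iterPrim a u (k + 1))) (iterPrim a u (k + 1 - j)) (Icc 0 1) := by
  induction j with
  | zero => rw [D_zero]; exact fun _ _ => rfl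
  | succ j ih =>
    intro x hx
    obtain ⟨l, hl⟩ : ∃ l, k = j + l + 1 := ⟨k - j - 1, by omega⟩
    have h1 : k + 1 - j = l + 1 + 1 := by omega
    have h2 : k + 1 - (j + 1) = l + 1 := by omega
    have ih' := ih (by omega)
    rw [h1] at ih'
    rw [D_succ, derivWithin_congr ih' (ih' hx), h2]
    exact (hasDerivWithinAt_primitive (iterPrim_continuousOn a hu l) (a (l + 1)) hx).derivWithin
      (uniqueDiffOn_unit x hx)

lemma isSobolev_iterPrim (hu : MemLp u 2 unitMeasure) (k : ℕ) :
    IsSobolev (k + 1) (iterPrim a u (k + 1)) ∧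
      D (k + 1) (iterPrim a u (k + 1)) =ᵐ[unitMeasure] u := by
  have hui : Integrable u unitMeasure := hu.integrable (by simp)
  have h0 : (0 : ℝ) ∈ Icc (0 : ℝ) 1 := ⟨le_rfl, zero_le_one⟩
  have h1 : (1 : ℝ) ∈ Icc (0 : ℝ) 1 := ⟨zero_le_one, le_rfl⟩
  have hDk : EqOn (D k (iterPrim a u (k + 1))) (iterPrim a u 1) (Icc 0 1) := by
    simpa using D_iterPrim a hui (le_refl k)
  have htop : D (k + 1) (iterPrim a u (k + 1)) =ᵐ[unitMeasure] u := by
    have hd := (intervalIntegrable_of_integrable_unit hui h0 h1).ae_hasDerivAt_integral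
    rw [uIcc_of_le zero_le_one] at hd
    filter_upwards [ae_mem_Ioo, (ae_restrict_iff' measurableSet_Icc).2 hd] with x hx hxd
    have hx' := Ioo_subset_Icc_self hx
    rw [D_succ, derivWithin_congr hDk (hDk hx'), derivWithin_eq_deriv_of_mem_Ioo _ hx]
    exact ((hxd 0 h0).const_add (a 0)).deriv
  refine ⟨⟨?_, ?_, hu.ae_eq htop.symm⟩, htop⟩
  · rw [Nat.add_sub_cancel, contDiffOn_nat_iff_continuousOn_differentiableOn_deriv
      uniqueDiffOn_unit]
    constructor
    · intro j hj
      refine ContinuousOn.congr ?_ (D_iterPrim a hui hj)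
      obtain ⟨l, hl⟩ : ∃ l, k + 1 - j = l + 1 := ⟨k - j, by omega⟩
      rw [hl]
      exact iterPrim_continuousOn a hui l
    · intro j hj
      refine DifferentiableOn.congr ?_ (D_iterPrim a hui hj.le)
      obtain ⟨l, hl⟩ : ∃ l, k + 1 - j = l + 1 + 1 := ⟨k - j - 1, by omega⟩
      rw [hl]
      exact fun x hx => (hasDerivWithinAt_primitive (iterPrim_continuousOn a hui l)
        (a (l + 1)) hx).differentiableWithinAt
  · exact absCont_congr (absCont_primitive hui (a 0)) hDk

end iterPrim

/-- The initial derivatives and the top derivative of an element of `W^{m,2}([0,1])` may be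
prescribed arbitrarily. -/
lemma exists_isSobolev_of_data (m : ℕ) (hm : 1 ≤ m) (a : Fin m → ℝ) {u : ℝ → ℝ}
    (hu : MemLp u 2 unitMeasure) : ∃ f, IsSobolev m f ∧ D m f =ᵐ[unitMeasure] u ∧
      ∀ j : Fin m, D j f 0 = a j := by
  obtain ⟨k, rfl⟩ : ∃ k, m = k + 1 := ⟨m - 1, by omega⟩
  let b : ℕ → ℝ := fun i => if h : k - i < k + 1 then a ⟨k - i, h⟩ else 0
  obtain ⟨h1, h2⟩ := isSobolev_iterPrim b hu k
  refine ⟨_, h1, h2, fun j => ?_⟩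
  have hj : (j : ℕ) ≤ k := Nat.lt_succ_iff.1 j.2
  rw [D_iterPrim b (hu.integrable (by simp)) hj ⟨le_rfl, zero_le_one⟩]
  obtain ⟨l, hl⟩ : ∃ l, k = j + l := ⟨k - j, by omega⟩
  have h3 : k + 1 - j = l + 1 := by omega
  rw [h3]
  simp only [iterPrim, intervalIntegral.integral_same, add_zero]
  have h4 : k - l < k + 1 := by omega
  simp only [b, dif_pos h4]
  congr 1
  ext
  simp
  omega

/-! ### The loss -/

namespace SmoothLoss

variable {ρ ψ : ℝ → ℝ}

lemma continuous (hρ : SmoothLoss ρ ψ) : Continuous ρ :=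
  continuous_iff_continuousAt.2 fun x => (hρ.hasDeriv x).continuousAt

lemma tangent_le (hρ : SmoothLoss ρ ψ) (x y : ℝ) : ρ x + ψ x * (y - x) ≤ ρ y := by
  rcases lt_trichotomy x y with h | rfl | h
  · have := hρ.convex.le_slope_of_hasDerivAt (mem_univ x) (mem_univ y) h (hρ.hasDeriv x)
    rw [slope_def_field, le_div_iff₀ (by linarith)] at this
    linarith
  · simp
  · have := hρ.convex.slope_le_of_hasDerivAt (mem_univ y) (mem_univ x) h (hρ.hasDeriv x)
    rw [slope_def_field, div_le_iff₀ (by linarith)] at this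
    nlinarith

/-- A convex loss with both increasing and decreasing parts grows at least linearly. -/
lemma exists_linear_growth (hρ : SmoothLoss ρ ψ) {x₁ x₂ : ℝ} (h₁ : 0 < ψ x₁) (h₂ : ψ x₂ < 0) :
    ∃ c C : ℝ, 0 < c ∧ ∀ x, c * |x| - C ≤ ρ x := by
  refine ⟨min (ψ x₁) (-ψ x₂), max (|ρ x₁| + ψ x₁ * |x₁|) (|ρ x₂| + -ψ x₂ * |x₂|),
    lt_min h₁ (by linarith), fun x => ?_⟩
  rcases le_total 0 x with h | h
  · have h3 := hρ.tangent_le x₁ x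
    have h4 : min (ψ x₁) (-ψ x₂) * |x| ≤ ψ x₁ * x := by
      rw [abs_of_nonneg h]
      exact mul_le_mul_of_nonneg_right (min_le_left _ _) h
    have h5 := le_max_left (|ρ x₁| + ψ x₁ * |x₁|) (|ρ x₂| + -ψ x₂ * |x₂|)
    have h6 := neg_abs_le (ρ x₁)
    have h7 := mul_le_mul_of_nonneg_left (le_abs_self x₁) h₁.le
    linarith
  · have h3 := hρ.tangent_le x₂ x
    have h4 : min (ψ x₁) (-ψ x₂) * |x| ≤ ψ x₂ * x := by
      rw [abs_of_nonpos h]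
      nlinarith [min_le_right (ψ x₁) (-ψ x₂)]
    have h5 := le_max_right (|ρ x₁| + ψ x₁ * |x₁|) (|ρ x₂| + -ψ x₂ * |x₂|)
    have h6 := neg_abs_le (ρ x₂)
    have h7 : -ψ x₂ * -|x₂| ≤ -ψ x₂ * x₂ :=
      mul_le_mul_of_nonneg_left (neg_abs_le x₂) (by linarith)
    linarith

end SmoothLoss

/-! ### Existence of smoothing splines -/

/-- A continuous penalized fit criterion attains its minimum on a finite-dimensional space of
pairs of fitted values and penalized components. -/
lemma exists_min_penalized {S : Type*} [NormedAddCommGroup S] [NormedSpace ℝ S]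
    [FiniteDimensional ℝ S] {n : ℕ} (hn : 1 ≤ n) (R : Submodule ℝ ((Fin n → ℝ) × S))
    {ρ : ℝ → ℝ} (hρc : Continuous ρ) {c C : ℝ} (hc : 0 < c) (hρ : ∀ x, c * |x| - C ≤ ρ x)
    {lam s : ℝ} (hlam : 0 < lam) (hs : 0 < s) (y : Fin n → ℝ) :
    ∃ w ∈ R, ∀ w' ∈ R,
      1 / (n : ℝ) * ∑ i, ρ ((y i - w.1 i) / s) + lam * ‖w.2‖ ^ 2 ≤
        1 / (n : ℝ) * ∑ i, ρ ((y i - w'.1 i) / s) + lam * ‖w'.2‖ ^ 2 := by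
  have : ProperSpace R := FiniteDimensional.proper ℝ R
  have hn0 : (0 : ℝ) < n := by exact_mod_cast hn
  set J : (Fin n → ℝ) × S → ℝ := fun w =>
    1 / (n : ℝ) * ∑ i, ρ ((y i - w.1 i) / s) + lam * ‖w.2‖ ^ 2 with hJ
  have hJc : Continuous fun w : R => J w := by
    simp only [hJ]
    fun_prop
  have hlow : ∀ w, 1 / (n : ℝ) * ∑ i, c * |(y i - w.1 i) / s| - C + lam * ‖w.2‖ ^ 2 ≤ J w := by
    intro w
    have h1 : ∑ i, (c * |(y i - w.1 i) / s| - C) ≤ ∑ i, ρ ((y i - w.1 i) / s) :=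
      Finset.sum_le_sum fun i _ => hρ _
    rw [Finset.sum_sub_distrib] at h1
    simp only [Finset.sum_const, Finset.card_univ, Fintype.card_fin, nsmul_eq_mul] at h1
    have h2 := mul_le_mul_of_nonneg_left h1 (by positivity : 0 ≤ 1 / (n : ℝ))
    rw [mul_sub, ← mul_assoc (1 / (n : ℝ)) (n : ℝ) C, one_div_mul_cancel hn0.ne', one_mul] at h2
    simp only [hJ]
    linarith
  set b := |J 0 + C| with hb
  have hev : ∀ᶠ w : R in cocompact R, J (0 : R) ≤ J w := by
    rw [← Metric.cobounded_eq_cocompact]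
    filter_upwards [eventually_cobounded_le_norm (E := R)
      (max (∑ i, |y i| + b * n * s / c) (1 + b / lam))] with w hw
    refine le_trans ?_ (hlow w)
    have hb0 : J (0 : R) + C ≤ b := le_abs_self _
    have hsum : 0 ≤ 1 / (n : ℝ) * ∑ i, c * |(y i - w.1.1 i) / s| := by positivity
    rw [Submodule.coe_norm, Prod.norm_def, le_max_iff] at hw
    rcases hw with hw | hw
    · have hr0 : 0 ≤ ∑ i, |y i| + b * n * s / c := by positivity
      have hw' := (le_max_left _ _).trans hw
      have hne : Nonempty (Fin n) := ⟨⟨0, hn⟩⟩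
      obtain ⟨i, -, hi⟩ := Finset.exists_max_image Finset.univ (fun i => ‖w.1.1 i‖)
        Finset.univ_nonempty
      have h1 : ‖w.1.1‖ ≤ ‖w.1.1 i‖ := (pi_norm_le_iff_of_nonneg (norm_nonneg _)).2 fun j =>
        hi j (Finset.mem_univ j)
      rw [Real.norm_eq_abs (w.1.1 i)] at h1
      have h2 : |y i| ≤ ∑ i, |y i| :=
        Finset.single_le_sum (f := fun i => |y i|) (fun _ _ => abs_nonneg _) (Finset.mem_univ i)
      have h3 : b * n * s / c ≤ |y i - w.1.1 i| := by
        have := abs_sub_abs_le_abs_sub (w.1.1 i) (y i)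
        rw [abs_sub_comm] at this
        linarith
      have h4 : c * |(y i - w.1.1 i) / s| ≤ ∑ i, c * |(y i - w.1.1 i) / s| :=
        Finset.single_le_sum (f := fun i => c * |(y i - w.1.1 i) / s|)
          (fun _ _ => by positivity) (Finset.mem_univ i)
      have h5 : b * n ≤ c * |(y i - w.1.1 i) / s| := by
        rw [abs_div, abs_of_pos hs, ← mul_div_assoc, le_div_iff₀ hs]
        rw [div_le_iff₀ hc] at h3
        linarith
      have h6 : b ≤ 1 / (n : ℝ) * ∑ i, c * |(y i - w.1.1 i) / s| := by
        rw [one_div, ← div_eq_inv_mul, le_div_iff₀ hn0]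
        linarith
      have h7 : 0 ≤ lam * ‖w.1.2‖ ^ 2 := by positivity
      linarith
    · have hw' := (le_max_right _ _).trans hw
      have hbl : 0 ≤ b / lam := by positivity
      have h1 : b ≤ lam * ‖w.1.2‖ ^ 2 := by
        rw [← div_le_iff₀' hlam]
        nlinarith
      linarith
  obtain ⟨w, hw⟩ := hJc.exists_forall_le' (0 : R) hev
  exact ⟨w, w.2, fun w' hw' => hw ⟨w', hw'⟩⟩

/-- Smoothing splines exist: the objective depends on `f` through its values at the design points
and the norm of its top derivative, so that the top derivative may be projected onto the
finite-dimensional span of the kernels representing these values. -/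
theorem exists_isSmoothingSpline {m : ℕ} (hm : 1 ≤ m) {ρ : ℝ → ℝ} (hρc : Continuous ρ) {c C : ℝ}
    (hc : 0 < c) (hρ : ∀ x, c * |x| - C ≤ ρ x) {lam : ℝ} (hlam : 0 < lam) {n : ℕ} (hn : 1 ≤ n)
    (t : Fin n → ℝ) (ht : ∀ i, t i ∈ Icc (0 : ℝ) 1) (y : Fin n → ℝ) {s : ℝ} (hs : 0 < s) :
    ∃ f, IsSmoothingSpline m ρ lam t y s f := by
  choose r hr using fun i => exists_taylor_kernel m hm (ht i)
  let S : Submodule ℝ (Lp ℝ 2 unitMeasure) := Submodule.span ℝ (range r)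
  have hS : FiniteDimensional ℝ S := FiniteDimensional.span_of_finite ℝ (Set.finite_range r)
  let p : (Fin m → ℝ) → Fin n → ℝ := fun a i =>
    ∑ j : Fin m, a j * (t i ^ (j : ℕ) / (j : ℕ).factorial)
  let T : (Fin m → ℝ) × S →ₗ[ℝ] (Fin n → ℝ) × S :=
    { toFun := fun v => (fun i => p v.1 i + inner ℝ (r i) (v.2 : Lp ℝ 2 unitMeasure), v.2)
      map_add' := fun v w => by
        refine Prod.ext (funext fun i => ?_) rfl
        simp only [p, Prod.fst_add, Prod.snd_add, Pi.add_apply, add_mul, Finset.sum_add_distrib,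
          Submodule.coe_add, inner_add_right]
        ring
      map_smul' := fun c v => by
        refine Prod.ext (funext fun i => ?_) rfl
        simp only [p, Prod.smul_fst, Prod.smul_snd, Pi.smul_apply, smul_eq_mul,
          Submodule.coe_smul, inner_smul_right, RingHom.id_apply, mul_add, Finset.mul_sum,
          mul_assoc] }
  obtain ⟨-, ⟨v, rfl⟩, hv⟩ := exists_min_penalized hn (LinearMap.range T) hρc hc hρ hlam hs y
  obtain ⟨f, hf, hDf, hDf0⟩ := exists_isSobolev_of_data m hm v.1
    (Lp.memLp (v.2 : Lp ℝ 2 unitMeasure))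
  have htop : topDeriv m hm ⟨f, hf⟩ = v.2 := by
    refine Lp.ext ?_
    exact hf.memLp.coeFn_toLp.trans hDf
  have hval : ∀ i, f (t i) = (T v).1 i := fun i => by
    have := hr i ⟨f, hf⟩
    rw [htop] at this
    simp only [hDf0] at this
    exact this
  refine ⟨f, hf, fun g hg => ?_⟩
  have hproj : ∀ i, inner ℝ (r i) (topDeriv m hm ⟨g, hg⟩) =
      inner ℝ (r i) ((S.orthogonalProjectionOnto (topDeriv m hm ⟨g, hg⟩) : S) :
        Lp ℝ 2 unitMeasure) := fun i => by
    have h1 : r i ∈ S := Submodule.subset_span (mem_range_self i)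
    exact (Submodule.inner_orthogonalProjectionOnto_eq_of_mem_left (⟨r i, h1⟩ : S)
      (topDeriv m hm ⟨g, hg⟩)).symm
  set w : (Fin m → ℝ) × S :=
    (fun j => D j g 0, S.orthogonalProjectionOnto (topDeriv m hm ⟨g, hg⟩)) with hw
  have hgval : ∀ i, g (t i) = (T w).1 i := fun i => by
    have := hr i ⟨g, hg⟩
    rw [hproj] at this
    exact this
  have hmin := hv (T w) ⟨w, rfl⟩
  have hnf : l2Sq (D m f) = ‖(T v).2‖ ^ 2 := by
    rw [l2Sq_eq_norm_toLp hf.memLp]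
    change ‖topDeriv m hm ⟨f, hf⟩‖ ^ 2 = _
    rw [htop]
    rfl
  have hng : ‖(T w).2‖ ^ 2 ≤ l2Sq (D m g) := by
    rw [l2Sq_eq_norm_toLp hg.memLp]
    exact pow_le_pow_left₀ (norm_nonneg _) (Submodule.norm_orthogonalProjectionOnto_apply_le S _) 2
  simp only [objective, hval, hgval, hnf]
  refine hmin.trans ?_
  gcongr

/-! ### Symmetrization and contraction -/

section Contraction

variable {ι : Type*} [Fintype ι] [Nonempty ι]

/-- The maximum of finitely many real numbers. -/
noncomputable def finMax (c : ι → ℝ) : ℝ := Finset.univ.sup' Finset.univ_nonempty c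

lemma le_finMax (c : ι → ℝ) (i : ι) : c i ≤ finMax c := Finset.le_sup' c (Finset.mem_univ i)

lemma finMax_le {c : ι → ℝ} {b : ℝ} (h : ∀ i, c i ≤ b) : finMax c ≤ b :=
  Finset.sup'_le _ _ fun i _ => h i

lemma exists_eq_finMax (c : ι → ℝ) : ∃ i, finMax c = c i := by
  obtain ⟨i, -, hi⟩ := Finset.exists_mem_eq_sup' (Finset.univ_nonempty (α := ι)) c
  exact ⟨i, hi⟩

lemma abs_finMax_le {c : ι → ℝ} {b : ℝ} (h : ∀ i, |c i| ≤ b) : |finMax c| ≤ b := by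
  obtain ⟨i, hi⟩ := exists_eq_finMax c
  rw [hi]
  exact h i

lemma measurable_finMax {X : Type*} [MeasurableSpace X] {f : X → ι → ℝ}
    (hf : ∀ i, Measurable fun e => f e i) : Measurable fun e => finMax (f e) := by
  have h := Finset.measurable_sup' (Finset.univ_nonempty (α := ι))
    (f := fun i e => f e i) fun i _ => hf i
  have h2 : (fun e => finMax (f e)) =
      Finset.univ.sup' Finset.univ_nonempty fun i e => f e i := by
    funext e
    exact (Finset.sup'_apply (Finset.univ_nonempty (α := ι)) (fun i e => f e i) e).symm
  rw [h2]
  exact h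

lemma integrable_finMax {X : Type*} [MeasurableSpace X] {μ : Measure X} [IsFiniteMeasure μ]
    {f : X → ι → ℝ} (hf : ∀ i, Measurable fun e => f e i) {b : ℝ} (hb : ∀ e i, |f e i| ≤ b) :
    Integrable (fun e => finMax (f e)) μ :=
  Integrable.of_bound (measurable_finMax hf).aestronglyMeasurable b
    (Eventually.of_forall fun e => abs_finMax_le (hb e))

/-- The deterministic contraction step: perturbations of opposite sign may be replaced by the
linear ones that dominate them. -/
lemma finMax_add_finMax_le {c p d : ι → ℝ} {L : ℝ}
    (hd : ∀ i j, d i - d j ≤ L * |p i - p j|) :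
    finMax (fun i => c i + d i) + finMax (fun i => c i - d i) ≤
      finMax (fun i => c i + L * p i) + finMax (fun i => c i - L * p i) := by
  obtain ⟨i, hi⟩ := exists_eq_finMax fun i => c i + d i
  obtain ⟨j, hj⟩ := exists_eq_finMax fun i => c i - d i
  rw [hi, hj]
  have h := hd i j
  have hpi := le_finMax (fun i => c i + L * p i) i
  have hpj := le_finMax (fun i => c i + L * p i) j
  have hmi := le_finMax (fun i => c i - L * p i) i
  have hmj := le_finMax (fun i => c i - L * p i) j
  rcases abs_cases (p i - p j) with ⟨h1, -⟩ | ⟨h1, -⟩ <;> rw [h1] at h <;> nlinarith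

/-- One step of symmetrization and contraction: the expected maximum of a family with one centred
random perturbation, Lipschitz in a parameter `p`, is at most the average of the maxima with the
perturbation replaced by `± 2 L p`. -/
lemma integral_finMax_le {X : Type*} [MeasurableSpace X] (μ : Measure X) [IsProbabilityMeasure μ]
    {c p : ι → ℝ} {d : X → ι → ℝ} {L b : ℝ} (hmeas : ∀ i, Measurable fun e => d e i)
    (hb : ∀ e i, |d e i| ≤ b) (hd : ∀ e i j, |d e i - d e j| ≤ L * |p i - p j|)
    (hmean : ∀ i, ∫ e, d e i ∂μ = 0) :
    ∫ e, finMax (fun i => c i + d e i) ∂μ ≤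
      (finMax (fun i => c i + 2 * L * p i) + finMax (fun i => c i - 2 * L * p i)) / 2 := by
  -- `G e e'` is the maximum for the difference of two independent copies
  set G : X → X → ℝ := fun e e' => finMax fun i => c i + (d e i - d e' i) with hG
  obtain ⟨cb, hcb⟩ : ∃ cb, ∀ i, |c i| ≤ cb := ⟨finMax fun i => |c i|, le_finMax fun i => |c i|⟩
  have hbd : ∀ (z : X × X) i, |c i + (d z.1 i - d z.2 i)| ≤ cb + (b + b) := fun z i =>
    (abs_add_le _ _).trans (add_le_add (hcb i) ((abs_sub _ _).trans (add_le_add (hb _ _) (hb _ _))))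
  have hGint : Integrable (fun z : X × X => G z.1 z.2) (μ.prod μ) :=
    integrable_finMax (f := fun (z : X × X) i => c i + (d z.1 i - d z.2 i))
      (fun i => measurable_const.add (((hmeas i).comp measurable_fst).sub
        ((hmeas i).comp measurable_snd))) hbd
  have hdint : ∀ i, Integrable (fun e => d e i) μ := fun i =>
    Integrable.of_bound (hmeas i).aestronglyMeasurable b (Eventually.of_forall fun e => hb e i)
  have hGe : ∀ e, Integrable (G e) μ := fun e =>
    integrable_finMax (f := fun e' i => c i + (d e i - d e' i))
      (fun i => measurable_const.add (measurable_const.sub (hmeas i))) fun e' => hbd (e, e')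
  have h1 : ∀ e, finMax (fun i => c i + d e i) ≤ ∫ e', G e e' ∂μ := fun e => by
    refine finMax_le fun i => ?_
    have h2 : ∫ e', (c i + (d e i - d e' i)) ∂μ = c i + d e i := by
      have h0 : Integrable (fun e' => d e i - d e' i) μ := (integrable_const _).sub (hdint i)
      rw [integral_add (integrable_const _) h0, integral_sub (integrable_const _) (hdint i),
        hmean i]
      simp
    rw [← h2]
    exact integral_mono ((integrable_const _).add ((integrable_const _).sub (hdint i))) (hGe e)
      fun e' => le_finMax (fun i => c i + (d e i - d e' i)) i
  have h3 : ∫ e, finMax (fun i => c i + d e i) ∂μ ≤ ∫ e, ∫ e', G e e' ∂μ ∂μ :=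
    integral_mono (integrable_finMax (fun i => measurable_const.add (hmeas i)) (b := cb + b)
      fun e i => (abs_add_le _ _).trans (add_le_add (hcb i) (hb e i))) hGint.integral_prod_left h1
  have h4 : ∫ e, ∫ e', G e e' ∂μ ∂μ = ∫ z, G z.1 z.2 ∂(μ.prod μ) := (integral_prod _ hGint).symm
  have h5 : ∫ z, G z.2 z.1 ∂(μ.prod μ) = ∫ z, G z.1 z.2 ∂(μ.prod μ) :=
    integral_prod_swap (fun z : X × X => G z.1 z.2)
  have h6 : ∫ z, (G z.1 z.2 + G z.2 z.1) ∂(μ.prod μ) ≤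
      ∫ _, (finMax (fun i => c i + 2 * L * p i) + finMax (fun i => c i - 2 * L * p i))
        ∂(μ.prod μ) := by
    refine integral_mono (hGint.add hGint.swap) (integrable_const _) fun z => ?_
    have h7 : G z.2 z.1 = finMax fun i => c i - (d z.1 i - d z.2 i) := by
      simp only [hG]
      congr 1
      funext i
      ring
    simp only [h7]
    refine finMax_add_finMax_le fun i j => ?_
    have hi := (abs_le.1 (hd z.1 i j)).2
    have hj := (abs_le.1 (hd z.2 i j)).1
    linarith
  have hGswap : Integrable (fun z : X × X => G z.2 z.1) (μ.prod μ) := hGint.swap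
  rw [integral_add hGint hGswap, integral_const, probReal_univ, one_smul] at h6
  linarith

/-- The expected maximum of a centred empirical process over finitely many points of a ball of
radius `r` in a Hilbert space. By induction on the number of coordinates: each step replaces a
random summand by a Rademacher multiple of a vector, which is absorbed by the parallelogram law. -/
lemma integral_finMax_process_le {X H : Type*} [MeasurableSpace X] [NormedAddCommGroup H]
    [InnerProductSpace ℝ H] (μ : Measure X) [IsProbabilityMeasure μ] {x : ι → H} {r a b L : ℝ}
    (hx : ∀ i, ‖x i‖ ≤ r) {d : X → ℝ → ℝ} (hmeas : ∀ h, Measurable fun e => d e h)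
    (hb : ∀ e h, |h| ≤ a → |d e h| ≤ b)
    (hd : ∀ e h h', |h| ≤ a → |h'| ≤ a → |d e h - d e h'| ≤ L * |h - h'|)
    (hmean : ∀ h, |h| ≤ a → ∫ e, d e h ∂μ = 0) (n : ℕ) (v : H) (R : Fin n → H)
    (hR : ∀ k i, |inner ℝ (R k) (x i)| ≤ a) :
    ∫ e : Fin n → X, finMax (fun i => inner ℝ v (x i) + ∑ k, d (e k) (inner ℝ (R k) (x i)))
      ∂(Measure.pi fun _ => μ) ≤ r * √(‖v‖ ^ 2 + 4 * L ^ 2 * ∑ k, ‖R k‖ ^ 2) := by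
  induction n generalizing v with
  | zero =>
    simp only [Finset.univ_eq_empty, Finset.sum_empty, add_zero, mul_zero,
      Real.sqrt_sq (norm_nonneg _), integral_const, probReal_univ, one_smul]
    refine finMax_le fun i => (real_inner_le_norm _ _).trans ?_
    rw [mul_comm]
    exact mul_le_mul_of_nonneg_right (hx i) (norm_nonneg _)
  | succ n ih =>
    have hr : 0 ≤ r := (norm_nonneg _).trans (hx (Classical.arbitrary ι))
    obtain ⟨vb, hvb⟩ : ∃ vb, ∀ (w : H) i, |inner ℝ w (x i)| ≤ vb w :=
      ⟨fun w => ‖w‖ * r, fun w i => (abs_real_inner_le_norm _ _).trans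
        (mul_le_mul_of_nonneg_left (hx i) (norm_nonneg _))⟩
    set R' : Fin n → H := fun k => R k.succ with hR'
    have hsumb : ∀ (e : Fin n → X) i, |∑ k, d (e k) (inner ℝ (R' k) (x i))| ≤ n * b := by
      intro e i
      refine (Finset.abs_sum_le_sum_abs _ _).trans ?_
      refine (Finset.sum_le_sum fun k _ => hb (e k) _ (hR k.succ i)).trans (le_of_eq ?_)
      simp
    have hmsum : ∀ i, Measurable fun e : Fin n → X => ∑ k, d (e k) (inner ℝ (R' k) (x i)) :=
      fun i => Finset.measurable_sum _ fun k _ => (hmeas _).comp (measurable_pi_apply k)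
    have hint : ∀ w : H, Integrable (fun e : Fin n → X =>
        finMax fun i => inner ℝ w (x i) + ∑ k, d (e k) (inner ℝ (R' k) (x i)))
        (Measure.pi fun _ => μ) := fun w =>
      integrable_finMax (fun i => measurable_const.add (hmsum i)) (b := vb w + n * b)
        fun e i => (abs_add_le _ _).trans (add_le_add (hvb w i) (hsumb e i))
    set g : X × (Fin n → X) → ℝ := fun z => finMax fun i =>
      (inner ℝ v (x i) + ∑ k, d (z.2 k) (inner ℝ (R' k) (x i))) + d z.1 (inner ℝ (R 0) (x i))
      with hg
    have hgint : Integrable g (μ.prod (Measure.pi fun _ => μ)) :=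
      integrable_finMax (fun i => (measurable_const.add ((hmsum i).comp measurable_snd)).add
        ((hmeas _).comp measurable_fst)) (b := vb v + n * b + b)
        fun z i => (abs_add_le _ _).trans (add_le_add ((abs_add_le _ _).trans
          (add_le_add (hvb v i) (hsumb z.2 i))) (hb _ _ (hR 0 i)))
    have h1 : ∫ e : Fin (n + 1) → X,
        finMax (fun i => inner ℝ v (x i) + ∑ k, d (e k) (inner ℝ (R k) (x i)))
        ∂(Measure.pi fun _ => μ) = ∫ z, g z ∂(μ.prod (Measure.pi fun _ => μ)) := by
      rw [← (measurePreserving_piFinSuccAbove (fun _ : Fin (n + 1) => μ) 0).integral_comp' g]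
      refine integral_congr_ae (Eventually.of_forall fun e => ?_)
      simp only [hg, hR']
      congr 1
      funext i
      rw [Fin.sum_univ_succ]
      simp only [MeasurableEquiv.piFinSuccAbove, Fin.insertNthEquiv, MeasurableEquiv.coe_mk,
        Equiv.coe_fn_symm_mk, Fin.removeNth, Fin.zero_succAbove]
      ring
    set w : H := (2 * L) • R 0 with hw
    have h2 : ∀ e : Fin n → X, ∫ e₀, g (e₀, e) ∂μ ≤
        (finMax (fun i => inner ℝ (v + w) (x i) + ∑ k, d (e k) (inner ℝ (R' k) (x i))) +
          finMax (fun i => inner ℝ (v - w) (x i) + ∑ k, d (e k) (inner ℝ (R' k) (x i)))) / 2 := by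
      intro e
      refine (integral_finMax_le μ (p := fun i => inner ℝ (R 0) (x i)) (L := L)
        (c := fun i => inner ℝ v (x i) + ∑ k, d (e k) (inner ℝ (R' k) (x i)))
        (d := fun e₀ i => d e₀ (inner ℝ (R 0) (x i)))
        (fun i => hmeas _) (fun e₀ i => hb e₀ _ (hR 0 i))
        (fun e₀ i j => hd e₀ _ _ (hR 0 i) (hR 0 j)) (fun i => hmean _ (hR 0 i))).trans
        (le_of_eq ?_)
      congr 3
      · funext i
        rw [inner_add_left, hw, inner_smul_left]
        simp
        ring
      · funext i
        rw [inner_sub_left, hw, inner_smul_left]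
        simp
        ring
    set K := 4 * L ^ 2 * ∑ k, ‖R' k‖ ^ 2 with hK
    have hK0 : 0 ≤ K := by positivity
    have h3 : ∫ z, g z ∂(μ.prod (Measure.pi fun _ => μ)) ≤
        (r * √(‖v + w‖ ^ 2 + K) + r * √(‖v - w‖ ^ 2 + K)) / 2 := by
      rw [integral_prod_symm _ hgint]
      refine (integral_mono hgint.integral_prod_right
        (((hint (v + w)).add (hint (v - w))).div_const 2) h2).trans ?_
      simp only [Pi.add_apply]
      rw [integral_div, integral_add (hint _) (hint _)]
      have := ih (v + w) R' fun k i => hR k.succ i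
      have := ih (v - w) R' fun k i => hR k.succ i
      linarith
    have hpar : ‖v + w‖ ^ 2 + ‖v - w‖ ^ 2 = 2 * (‖v‖ ^ 2 + ‖w‖ ^ 2) := by
      have := parallelogram_law_with_norm ℝ v w
      nlinarith
    have hwn : ‖w‖ ^ 2 = 4 * L ^ 2 * ‖R 0‖ ^ 2 := by
      rw [hw, norm_smul, mul_pow, Real.norm_eq_abs, sq_abs]
      ring
    have hsq : (√(‖v + w‖ ^ 2 + K) + √(‖v - w‖ ^ 2 + K)) / 2 ≤
        √(‖v‖ ^ 2 + 4 * L ^ 2 * ∑ k, ‖R k‖ ^ 2) := by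
      apply Real.le_sqrt_of_sq_le
      have e1 := Real.sq_sqrt (by positivity : 0 ≤ ‖v + w‖ ^ 2 + K)
      have e2 := Real.sq_sqrt (by positivity : 0 ≤ ‖v - w‖ ^ 2 + K)
      rw [Fin.sum_univ_succ]
      simp only [hK, hR'] at *
      nlinarith [sq_nonneg (√(‖v + w‖ ^ 2 + K) - √(‖v - w‖ ^ 2 + K))]
    rw [h1]
    refine h3.trans ?_
    calc _ = r * ((√(‖v + w‖ ^ 2 + K) + √(‖v - w‖ ^ 2 + K)) / 2) := by ring
      _ ≤ _ := mul_le_mul_of_nonneg_left hsq hr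

end Contraction

/-! ### The excess loss -/

/-- The loss of the residual `e - h` at scale `σ`, in excess of its linearization at `h = 0` and
multiplied by `σ`. -/
noncomputable def excess (ρ ψ : ℝ → ℝ) (σ e h : ℝ) : ℝ :=
  σ * (ρ ((e - h) / σ) - ρ (e / σ)) + ψ (e / σ) * h

namespace SmoothLoss

variable {ρ ψ : ℝ → ℝ}

lemma continuous_score (hρ : SmoothLoss ρ ψ) : Continuous ψ := by
  obtain ⟨K, hK⟩ := hρ.lipschitz
  exact hK.continuous

lemma continuous_excess (hρ : SmoothLoss ρ ψ) (σ h : ℝ) :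
    Continuous fun e => excess ρ ψ σ e h := by
  have h1 := hρ.continuous
  have h2 := hρ.continuous_score
  unfold excess
  fun_prop

@[simp]
lemma excess_zero (σ e : ℝ) : excess ρ ψ σ e 0 = 0 := by simp [excess]

/-- Increments of the excess loss, from the tangent inequality. -/
lemma excess_sub_ge (hρ : SmoothLoss ρ ψ) {σ : ℝ} (hσ : 0 < σ) (e h h' : ℝ) :
    (ψ (e / σ) - ψ ((e - h) / σ)) * (h' - h) ≤ excess ρ ψ σ e h' - excess ρ ψ σ e h := by
  have h1 := mul_le_mul_of_nonneg_left (hρ.tangent_le ((e - h) / σ) ((e - h') / σ)) hσ.le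
  have h2 : σ * (ρ ((e - h) / σ) + ψ ((e - h) / σ) * ((e - h') / σ - (e - h) / σ)) =
      σ * ρ ((e - h) / σ) + ψ ((e - h) / σ) * (h - h') := by
    field_simp
    ring
  rw [h2] at h1
  unfold excess
  linarith

lemma excess_nonneg (hρ : SmoothLoss ρ ψ) {σ : ℝ} (hσ : 0 < σ) (e h : ℝ) :
    0 ≤ excess ρ ψ σ e h := by
  simpa using hρ.excess_sub_ge hσ e 0 h

/-- A lower bound for the excess loss in terms of an increment of the score. -/
lemma half_mul_le_excess (hρ : SmoothLoss ρ ψ) {σ : ℝ} (hσ : 0 < σ) (e h : ℝ) :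
    (ψ (e / σ) - ψ (e / σ + -(h / 2) / σ)) * (h / 2) ≤ excess ρ ψ σ e h := by
  have h1 := hρ.excess_sub_ge hσ e (h / 2) h
  have h2 := hρ.excess_nonneg hσ e (h / 2)
  have h3 : e / σ + -(h / 2) / σ = (e - h / 2) / σ := by ring
  rw [h3]
  linarith

lemma abs_excess_sub_le (hρ : SmoothLoss ρ ψ) {K : NNReal} (hK : LipschitzWith K ψ) {σ : ℝ}
    (hσ : 0 < σ) {a : ℝ} (e : ℝ) {h h' : ℝ} (hh : |h| ≤ a) (hh' : |h'| ≤ a) :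
    |excess ρ ψ σ e h - excess ρ ψ σ e h'| ≤ K / σ * a * |h - h'| := by
  have key : ∀ h h' : ℝ, |h| ≤ a →
      excess ρ ψ σ e h - excess ρ ψ σ e h' ≤ K / σ * a * |h - h'| := by
    intro h h' hh
    have h1 := hρ.excess_sub_ge hσ e h h'
    have h2 : |ψ (e / σ) - ψ ((e - h) / σ)| ≤ K / σ * a := by
      have := hK.dist_le_mul (e / σ) ((e - h) / σ)
      rw [Real.dist_eq, Real.dist_eq] at this
      have h3 : e / σ - (e - h) / σ = h / σ := by ring
      rw [h3, abs_div, abs_of_pos hσ] at this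
      refine this.trans ?_
      rw [← mul_div_assoc, div_mul_eq_mul_div]
      gcongr
    have h4 : -((ψ (e / σ) - ψ ((e - h) / σ)) * (h' - h)) ≤
        |ψ (e / σ) - ψ ((e - h) / σ)| * |h - h'| := by
      rw [abs_sub_comm h h', ← abs_mul]
      exact neg_le_abs _
    have h5 := mul_le_mul_of_nonneg_right h2 (abs_nonneg (h - h'))
    linarith
  rw [abs_le]
  constructor
  · have := key h' h hh'
    rw [abs_sub_comm] at this
    linarith
  · exact key h h' hh

/-- Replacing the scale changes increments of the scaled loss little, by the slow variation of the
score. -/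
lemma abs_scale_change_le (hρ : SmoothLoss ρ ψ) {M s σ : ℝ} (hs : 0 < s) (hσ : 0 < σ)
    (hM : ∀ x : ℝ, |ψ (1 / s * x) - ψ (1 / σ * x)| ≤ M * |1 / s - 1 / σ|) (e h : ℝ) :
    |s * (ρ ((e - h) / s) - ρ (e / s)) - σ * (ρ ((e - h) / σ) - ρ (e / σ))| ≤
      M * |1 / s - 1 / σ| * |h| := by
  have hder : ∀ {r : ℝ}, 0 < r → ∀ z : ℝ,
      HasDerivAt (fun z => r * ρ ((e - z) / r)) (-ψ (1 / r * (e - z))) z := by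
    intro r hr z
    have h1 : HasDerivAt (fun z : ℝ => (e - z) / r) (-1 / r) z :=
      ((hasDerivAt_id z).const_sub e).div_const r
    have h2 := ((hρ.hasDeriv ((e - z) / r)).comp z h1).const_mul r
    have h3 : -ψ (1 / r * (e - z)) = r * (ψ ((e - z) / r) * (-1 / r)) := by
      rw [one_div_mul_eq_div]
      field_simp
    rw [h3]
    exact h2
  have hF := fun z (_ : z ∈ (univ : Set ℝ)) => ((hder hs z).sub (hder hσ z)).hasDerivWithinAt
    (s := univ)
  have hb : ∀ z ∈ (univ : Set ℝ),
      ‖-ψ (1 / s * (e - z)) - -ψ (1 / σ * (e - z))‖ ≤ M * |1 / s - 1 / σ| := fun z _ => by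
    rw [Real.norm_eq_abs, ← abs_neg]
    convert hM (e - z) using 2
    ring
  have := Convex.norm_image_sub_le_of_norm_hasDerivWithin_le hF hb convex_univ (mem_univ 0)
    (mem_univ h)
  simp only [Real.norm_eq_abs, sub_zero, Pi.sub_apply] at this
  convert this using 2
  ring

/-- Slow variation in the tails makes the score grow slower than every power. -/
lemma exists_abs_score_le (hρ : SmoothLoss ρ ψ) {b : ℝ} (hb : 0 < b) :
    ∃ A : ℝ, 0 ≤ A ∧ ∀ x, |ψ x| ≤ A * (1 + |x| ^ b) := by
  obtain ⟨K, hK⟩ := hρ.lipschitz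
  obtain ⟨M, hM⟩ := hρ.slow (1 / 2) (by norm_num)
  have hM2 : ∀ x, |ψ x| ≤ |ψ (x / 2)| + M := fun x => by
    have h1 := hM 2 1 (x / 2) (by norm_num) (by norm_num)
    have h2 : (2 : ℝ) * (x / 2) = x := by ring
    rw [h2, one_mul] at h1
    norm_num at h1
    have := abs_sub_abs_le_abs_sub (ψ x) (ψ (x / 2))
    linarith
  have hM0 : 0 ≤ M := by
    have := hM2 0
    rw [zero_div] at this
    linarith
  set q : ℝ := (2 : ℝ) ^ (-b) with hq
  have hq1 : q < 1 := Real.rpow_lt_one_of_one_lt_of_neg one_lt_two (by linarith)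
  set A₀ : ℝ := |ψ 0| + K
  set A₁ : ℝ := M / (1 - q)
  have hA₁ : 0 ≤ A₁ := div_nonneg hM0 (by linarith)
  have hA₀ : 0 ≤ A₀ := by positivity
  have hind : ∀ k : ℕ, ∀ x : ℝ, |x| ≤ 2 ^ k → |ψ x| ≤ A₀ + A₁ * |x| ^ b := by
    intro k
    have hsmall : ∀ x : ℝ, |x| ≤ 1 → |ψ x| ≤ A₀ + A₁ * |x| ^ b := fun x hx => by
      have h1 := hK.dist_le_mul x 0
      rw [Real.dist_eq, Real.dist_eq, sub_zero] at h1
      have h2 := abs_sub_abs_le_abs_sub (ψ x) (ψ 0)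
      have h3 : (K : ℝ) * |x| ≤ K := mul_le_of_le_one_right K.2 hx
      have h4 : 0 ≤ A₁ * |x| ^ b := by positivity
      simp only [A₀]
      linarith
    induction k with
    | zero => intro x hx; exact hsmall x (by simpa using hx)
    | succ k ih =>
      intro x hx
      rcases le_total |x| 1 with h | h
      · exact hsmall x h
      have h1 : |x / 2| = |x| / 2 := by rw [abs_div, abs_two]
      have h2 := ih (x / 2) (by rw [h1, div_le_iff₀ two_pos, ← pow_succ]; exact hx)
      have h3 : |x / 2| ^ b = |x| ^ b * q := by
        rw [h1, Real.div_rpow (abs_nonneg _) two_pos.le, hq, Real.rpow_neg two_pos.le,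
          div_eq_mul_inv]
      rw [h3] at h2
      have h4 : 1 ≤ |x| ^ b := Real.one_le_rpow h hb.le
      have h5 : M = A₁ * (1 - q) := by
        simp only [A₁]
        rw [div_mul_cancel₀]
        linarith
      have h6 : A₁ * (1 - q) ≤ A₁ * (1 - q) * |x| ^ b :=
        le_mul_of_one_le_right (by rw [← h5]; exact hM0) h4
      have := hM2 x
      linarith
  refine ⟨A₀ + A₁, by positivity, fun x => ?_⟩
  obtain ⟨k, hk⟩ := pow_unbounded_of_one_lt |x| one_lt_two
  have h1 := hind k x hk.le
  have h2 : 0 ≤ |x| ^ b := by positivity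
  nlinarith

/-- A small absolute moment of the errors makes the score square integrable. -/
lemma integrable_score_sq (hρ : SmoothLoss ρ ψ) {Ω : Type*} [MeasurableSpace Ω] {P : Measure Ω}
    [IsFiniteMeasure P] {e : Ω → ℝ} (he : Measurable e) {c : ℝ} (hc : 0 < c)
    (hmom : Integrable (fun ω => |e ω| ^ c) P) {σ : ℝ} (hσ : 0 < σ) :
    Integrable (fun ω => ψ (e ω / σ) ^ 2) P := by
  obtain ⟨A, hA, h⟩ := hρ.exists_abs_score_le (half_pos hc)
  have hint : Integrable (fun ω => 2 * A ^ 2 * (1 + (σ ^ c)⁻¹ * |e ω| ^ c)) P :=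
    ((integrable_const 1).add (hmom.const_mul _)).const_mul _
  refine hint.mono' ?_ (Eventually.of_forall fun ω => ?_)
  · exact ((hρ.continuous_score.measurable.comp (he.div_const σ)).pow_const 2).aestronglyMeasurable
  · rw [Real.norm_eq_abs, abs_of_nonneg (sq_nonneg _), ← sq_abs]
    have h1 := h (e ω / σ)
    set y := |e ω / σ| ^ (c / 2) with hy
    have hyc : y ^ 2 = (σ ^ c)⁻¹ * |e ω| ^ c := by
      rw [hy, ← Real.rpow_natCast, ← Real.rpow_mul (abs_nonneg _), abs_div, abs_of_pos hσ,
        Nat.cast_ofNat, div_mul_cancel₀ _ two_ne_zero, Real.div_rpow (abs_nonneg _) hσ.le]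
      ring
    rw [← hyc]
    have hy0 : 0 ≤ y := by positivity
    calc |ψ (e ω / σ)| ^ 2 ≤ (A * (1 + y)) ^ 2 := pow_le_pow_left₀ (abs_nonneg _) h1 2
      _ ≤ 2 * A ^ 2 * (1 + y ^ 2) := by
        nlinarith [mul_nonneg (sq_nonneg A) (sq_nonneg (1 - y))]

end SmoothLoss

/-! ### Consequences of the linearization of the mean score -/

/-- The mean score has the sign of the shift, at a linear rate. -/
lemma ScoreLinearization.exists_le_mul_integral {Ω : Type*} [MeasurableSpace Ω] {P : Measure Ω}
    {ψ : ℝ → ℝ} {e : Ω → ℝ} {σ : ℝ} (h : ScoreLinearization P ψ e σ) (hσ : 0 < σ) :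
    ∃ κ u₀ : ℝ, 0 < κ ∧ 0 < u₀ ∧ ∀ u : ℝ, |u| ≤ u₀ →
      κ * u ^ 2 ≤ u * ∫ ω, ψ (e ω / σ + u) ∂P := by
  obtain ⟨ξ, hξ, δ, lo, hi, hδ, hlo, hb⟩ := h
  have hξσ : 0 < ξ σ := hlo.trans_le (hb σ (by simpa using hδ.le)).1
  have ho := (hξ σ hσ).2
  rw [isLittleO_iff] at ho
  have hev := ho (half_pos hξσ)
  obtain ⟨u₁, hu₁, hball⟩ := Metric.eventually_nhds_iff.1 hev
  refine ⟨ξ σ / 2, u₁ / 2, half_pos hξσ, half_pos hu₁, fun u hu => ?_⟩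
  have h1 := hball (y := u) (by rw [Real.dist_eq, sub_zero]; linarith)
  rw [Real.norm_eq_abs, Real.norm_eq_abs, abs_abs] at h1
  set I := ∫ ω, ψ (e ω / σ + u) ∂P
  have h2 : |u| * |I - ξ σ * u| ≤ |u| * (ξ σ / 2 * |u|) :=
    mul_le_mul_of_nonneg_left h1 (abs_nonneg _)
  rw [← abs_mul] at h2
  have h3 := neg_abs_le (u * (I - ξ σ * u))
  have h4 : |u| * |u| = u ^ 2 := by rw [abs_mul_abs_self, sq]
  nlinarith

/-- The score takes both signs. -/
lemma ScoreLinearization.exists_signs {Ω : Type*} [MeasurableSpace Ω] {P : Measure Ω}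
    {ψ : ℝ → ℝ} {e : Ω → ℝ} {σ : ℝ} (h : ScoreLinearization P ψ e σ) (hσ : 0 < σ) :
    (∃ x, 0 < ψ x) ∧ ∃ x, ψ x < 0 := by
  obtain ⟨κ, u₀, hκ, hu₀, H⟩ := h.exists_le_mul_integral hσ
  constructor
  · by_contra! hcon
    have h1 := H u₀ (by rw [abs_of_pos hu₀])
    have h2 : ∫ ω, ψ (e ω / σ + u₀) ∂P ≤ 0 := integral_nonpos fun ω => hcon _
    nlinarith [mul_pos hκ (pow_pos hu₀ 2)]
  · by_contra! hcon
    have h1 := H (-u₀) (by rw [abs_neg, abs_of_pos hu₀])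
    have h2 : 0 ≤ ∫ ω, ψ (e ω / σ + -u₀) ∂P := integral_nonneg fun ω => hcon _
    nlinarith [mul_pos hκ (pow_pos hu₀ 2)]

/-- The mean excess loss is at least quadratic near the origin. -/
lemma SmoothLoss.exists_le_integral_excess {ρ ψ : ℝ → ℝ} (hρ : SmoothLoss ρ ψ) {Ω : Type*}
    [MeasurableSpace Ω] {P : Measure Ω} [IsProbabilityMeasure P] {e : Ω → ℝ} (he : Measurable e)
    {σ : ℝ} (hσ : 0 < σ) (hψ : ScoreLinearization P ψ e σ)
    (hint : Integrable (fun ω => ψ (e ω / σ)) P) :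
    ∃ κ a₀ : ℝ, 0 < κ ∧ 0 < a₀ ∧ ∀ h : ℝ, |h| ≤ a₀ →
      κ * h ^ 2 ≤ ∫ ω, excess ρ ψ σ (e ω) h ∂P := by
  obtain ⟨κ, u₀, hκ, hu₀, H⟩ := hψ.exists_le_mul_integral hσ
  obtain ⟨K, hK⟩ := hρ.lipschitz
  have h0 : ∫ ω, ψ (e ω / σ) ∂P = 0 := by
    obtain ⟨ξ, hξ, -⟩ := hψ
    exact (hξ σ hσ).1
  refine ⟨κ / (4 * σ), 2 * σ * u₀, by positivity, by positivity, fun h hh => ?_⟩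
  set u : ℝ := -(h / 2) / σ with hu
  have hu' : |u| ≤ u₀ := by
    rw [hu, abs_div, abs_neg, abs_div, abs_two, abs_of_pos hσ, div_div, div_le_iff₀ (by positivity)]
    linarith
  have hm : ∀ v : ℝ, Measurable fun ω => ψ (e ω / σ + v) := fun v =>
    hρ.continuous_score.measurable.comp ((he.div_const σ).add_const v)
  have hintd : Integrable (fun ω => ψ (e ω / σ) - ψ (e ω / σ + u)) P := by
    have hm0 := hm 0
    simp only [add_zero] at hm0
    refine Integrable.of_bound (hm0.sub (hm u)).aestronglyMeasurable (K * |u|)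
      (Eventually.of_forall fun ω => ?_)
    have := hK.dist_le_mul (e ω / σ) (e ω / σ + u)
    rw [Real.dist_eq, Real.dist_eq] at this
    simpa using this
  have hintu : Integrable (fun ω => ψ (e ω / σ + u)) P :=
    (hint.sub hintd).congr (Eventually.of_forall fun ω => by simp)
  have hW : Integrable (fun ω => excess ρ ψ σ (e ω) h) P := by
    refine Integrable.of_bound ((hρ.continuous_excess σ h).measurable.comp he).aestronglyMeasurable
      (K / σ * |h| * |h|) (Eventually.of_forall fun ω => ?_)
    have := hρ.abs_excess_sub_le hK hσ (e ω) (h := h) (h' := 0) le_rfl (by simp)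
    simpa using this
  have hmono := integral_mono (hintd.mul_const (h / 2)) hW
    fun ω => hρ.half_mul_le_excess hσ (e ω) h
  rw [integral_mul_const, integral_sub hint hintu, h0, zero_sub] at hmono
  refine le_trans ?_ hmono
  have hH := H u hu'
  have e1 : h = -(2 * σ * u) := by rw [hu]; field_simp
  rw [e1]
  set I := ∫ ω, ψ (e ω / σ + u) ∂P
  have h2 := mul_le_mul_of_nonneg_left hH hσ.le
  calc κ / (4 * σ) * (-(2 * σ * u)) ^ 2 = σ * (κ * u ^ 2) := by field_simp; ring
    _ ≤ _ := h2
    _ = _ := by ring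

/-! ### Two probability bounds -/

section Probability

variable {Ω : Type*} [MeasurableSpace Ω] {P : Measure Ω} [IsProbabilityMeasure P]
  {ε : ℕ → Ω → ℝ} {H : Type*} [NormedAddCommGroup H] [InnerProductSpace ℝ H]

/-- The joint law of the first `n` errors is a product measure. -/
lemma map_eq_pi (hε : ∀ i, Measurable (ε i)) (hindep : iIndepFun ε P)
    (hident : ∀ i, IdentDistrib (ε i) (ε 0) P P) (n : ℕ) :
    P.map (fun ω (k : Fin n) => ε k ω) = Measure.pi fun _ => P.map (ε 0) := by
  have h := hindep.precomp (g := fun k : Fin n => (k : ℕ)) Fin.val_injective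
  rw [iIndepFun_iff_map_fun_eq_pi_map fun k : Fin n => (hε k).aemeasurable] at h
  rw [h]
  congr 1
  funext k
  exact (hident k).map_eq

/-- Uniform deviation inequality for a centred empirical process indexed by a subset of a ball of
radius `r` in a Hilbert space, by Markov's inequality over a finite net. The probability is an outer
measure. -/
lemma measure_exists_sum_gt_le (hε : ∀ i, Measurable (ε i)) (hindep : iIndepFun ε P)
    (hident : ∀ i, IdentDistrib (ε i) (ε 0) P P) {A : Type*} {x : A → H} {g₀ : A}
    (hg₀ : x g₀ = 0) {r a b L : ℝ} (ha : 0 ≤ a)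
    (hx : ∀ g, ‖x g‖ ≤ r) (hL : 0 ≤ L) {d : ℝ → ℝ → ℝ}
    (hd0 : ∀ e, d e 0 = 0) (hmeas : ∀ h, Measurable fun e => d e h)
    (hb : ∀ e h, |h| ≤ a → |d e h| ≤ b)
    (hd : ∀ e h h', |h| ≤ a → |h'| ≤ a → |d e h - d e h'| ≤ L * |h - h'|)
    (hmean : ∀ h, |h| ≤ a → ∫ ω, d (ε 0 ω) h ∂P = 0) (n : ℕ) (R : Fin n → H)
    (hR : ∀ k g, |inner ℝ (R k) (x g)| ≤ a) {τ : ℝ} (hτ : 0 < τ) :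
    P {ω | ∃ g, τ < ∑ k : Fin n, d (ε k ω) (inner ℝ (R k) (x g))} ≤
      ENNReal.ofReal (r * (4 * L * √(∑ k : Fin n, ‖R k‖ ^ 2)) / τ) := by
  set μ := P.map (ε 0) with hμ
  have : IsProbabilityMeasure μ := Measure.isProbabilityMeasure_map (hε 0).aemeasurable
  have hmean' : ∀ h, |h| ≤ a → ∫ e, d e h ∂μ = 0 := fun h hh => by
    rw [hμ, integral_map (hε 0).aemeasurable (hmeas h).aestronglyMeasurable]
    exact hmean h hh
  -- a finite net for the vectors of values at the representers
  set p : A → Fin n → ℝ := fun g k => inner ℝ (R k) (x g) with hp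
  have hbdd : Bornology.IsBounded (range p) := by
    refine (Metric.isBounded_closedBall (x := (0 : Fin n → ℝ)) (r := a)).subset ?_
    rintro _ ⟨g, rfl⟩
    rw [mem_closedBall_zero_iff]
    exact (pi_norm_le_iff_of_nonneg ha).2 fun k => hR k g
  have htb : TotallyBounded (range p) := 
    hbdd.isCompact_closure.totallyBounded.subset subset_closure
  set ζ : ℝ := τ / (2 * (n * L + 1)) with hζ
  have hζ0 : 0 < ζ := by positivity
  obtain ⟨F, hFsub, hFfin, hFcov⟩ := Metric.finite_approx_of_totallyBounded htb ζ hζ0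
  obtain ⟨G, hG⟩ : ∃ G : Finset A, ∀ y ∈ F, ∃ g ∈ G, p g = y := by
    have : Nonempty A := ⟨g₀⟩
    choose! q hq using fun y (hy : y ∈ F) => hFsub hy
    classical
    exact ⟨hFfin.toFinset.image q, fun y hy => ⟨q y, Finset.mem_image_of_mem _
      (hFfin.mem_toFinset.2 hy), hq y hy⟩⟩
  classical
  set G' : Finset A := insert g₀ G with hG'
  have hne : Nonempty G' := ⟨⟨g₀, Finset.mem_insert_self _ _⟩⟩
  set Z : (Fin n → ℝ) → ℝ := fun e => finMax fun i : G' =>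
    inner ℝ (0 : H) (x i) + ∑ k : Fin n, d (e k) (inner ℝ (R k) (x i)) with hZ
  have hZm : ∀ i : G', Measurable fun e : Fin n → ℝ =>
      inner ℝ (0 : H) (x i) + ∑ k : Fin n, d (e k) (inner ℝ (R k) (x i)) := fun i =>
    measurable_const.add (Finset.measurable_sum _ fun k _ => (hmeas _).comp (measurable_pi_apply k))
  have hZint : Integrable Z (Measure.pi fun _ => μ) := by
    refine integrable_finMax hZm (b := n * b) fun e i => ?_
    rw [inner_zero_left, zero_add]
    refine (Finset.abs_sum_le_sum_abs _ _).trans ?_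
    refine (Finset.sum_le_sum fun k _ => hb (e k) _ (hR k i)).trans (le_of_eq ?_)
    simp
  have hZ0 : ∀ e, 0 ≤ Z e := fun e => by
    refine le_trans (le_of_eq ?_) (le_finMax _ ⟨g₀, Finset.mem_insert_self _ _⟩)
    simp [hg₀, hd0]
  have hZle : ∫ e, Z e ∂(Measure.pi fun _ => μ) ≤ r * (2 * L * √(∑ k : Fin n, ‖R k‖ ^ 2)) := by
    refine (integral_finMax_process_le μ (x := fun i : G' => x i) (fun i => hx i) hmeas hb hd
      hmean' n 0 R fun k i => hR k i).trans (le_of_eq ?_)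
    rw [norm_zero, zero_pow two_ne_zero, zero_add, Real.sqrt_mul (by positivity)]
    congr 2
    rw [show 4 * L ^ 2 = (2 * L) ^ 2 by ring, Real.sqrt_sq (by positivity)]
  have hmeasZ : Measurable Z := measurable_finMax hZm
  have hsub : {ω | ∃ g, τ < ∑ k : Fin n, d (ε k ω) (inner ℝ (R k) (x g))} ⊆
      (fun ω (k : Fin n) => ε k ω) ⁻¹' {e | τ / 2 ≤ Z e} := by
    rintro ω ⟨g, hg⟩
    obtain ⟨y, hyF, hy⟩ := mem_iUnion₂.1 (hFcov (mem_range_self g))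
    obtain ⟨g', hg'G, rfl⟩ := hG y hyF
    have hdist : ∀ k, |inner ℝ (R k) (x g) - inner ℝ (R k) (x g')| ≤ ζ := fun k =>
      (dist_le_pi_dist (p g) (p g') k).trans (Metric.mem_ball.1 hy).le
    have h1 : ∑ k : Fin n, d (ε k ω) (inner ℝ (R k) (x g)) - ∑ k : Fin n, d (ε k ω) (inner ℝ (R k) (x g')) ≤
        n * (L * ζ) := by
      rw [← Finset.sum_sub_distrib]
      refine (Finset.sum_le_sum fun k _ => (le_abs_self _).trans ((hd _ _ _ (hR k g)
        (hR k g')).trans (mul_le_mul_of_nonneg_left (hdist k) hL))).trans (le_of_eq ?_)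
      simp
    have h2 : n * (L * ζ) ≤ τ / 2 := by
      have hnL : (0 : ℝ) ≤ n * L := by positivity
      have : n * (L * ζ) = τ / 2 * (n * L / (n * L + 1)) := by
        rw [hζ]; field_simp
      rw [this]
      refine mul_le_of_le_one_right (by positivity) ?_
      rw [div_le_one (by positivity)]
      linarith
    have h3 := le_finMax (fun i : G' => inner ℝ (0 : H) (x i) +
      ∑ k : Fin n, d (ε k ω) (inner ℝ (R k) (x i))) ⟨g', Finset.mem_insert_of_mem hg'G⟩
    simp only [inner_zero_left, zero_add] at h3
    change τ / 2 ≤ Z fun k => ε k ω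
    simp only [hZ, inner_zero_left, zero_add]
    linarith
  have hmarkov := mul_meas_ge_le_integral_of_nonneg (Eventually.of_forall hZ0) hZint (τ / 2)
  calc P {ω | ∃ g, τ < ∑ k : Fin n, d (ε k ω) (inner ℝ (R k) (x g))}
      ≤ P ((fun ω (k : Fin n) => ε k ω) ⁻¹' {e | τ / 2 ≤ Z e}) := measure_mono hsub
    _ = (Measure.pi fun _ => μ) {e | τ / 2 ≤ Z e} := by
      rw [← Measure.map_apply (measurable_pi_lambda _ fun k : Fin n => hε k)
        (measurableSet_le measurable_const hmeasZ), map_eq_pi hε hindep hident]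
    _ = ENNReal.ofReal ((Measure.pi fun _ => μ).real {e | τ / 2 ≤ Z e}) := by
      rw [ofReal_measureReal]
    _ ≤ _ := by
      apply ENNReal.ofReal_le_ofReal
      rw [le_div_iff₀ hτ]
      linarith

/-- Chebyshev's inequality for a sum of vectors with independent centred coefficients. -/
lemma measure_norm_sum_smul_gt_le (hε : ∀ i, Measurable (ε i)) (hindep : iIndepFun ε P)
    (hident : ∀ i, IdentDistrib (ε i) (ε 0) P P) {φ : ℝ → ℝ} (hφ : Measurable φ)
    (hsq : Integrable (fun ω => φ (ε 0 ω) ^ 2) P) (hmean : ∫ ω, φ (ε 0 ω) ∂P = 0) (n : ℕ)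
    (R : Fin n → H) {τ : ℝ} (hτ : 0 < τ) :
    P {ω | τ < ‖∑ k : Fin n, φ (ε k ω) • R k‖ ^ 2} ≤
      ENNReal.ofReal ((∫ ω, φ (ε 0 ω) ^ 2 ∂P) * (∑ k : Fin n, ‖R k‖ ^ 2) / τ) := by
  have hid : ∀ i, IdentDistrib (fun ω => φ (ε i ω)) (fun ω => φ (ε 0 ω)) P P := fun i =>
    (hident i).comp hφ
  have hL2 : ∀ i, MemLp (fun ω => φ (ε i ω)) 2 P := fun i => by
    exact (hid i).memLp_iff.2 ((memLp_two_iff_integrable_sq (f := fun ω => φ (ε 0 ω))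
      (hφ.comp (hε 0)).aestronglyMeasurable).2 hsq)
  have hexp : ∀ ω, ‖∑ k : Fin n, φ (ε k ω) • R k‖ ^ 2 =
      ∑ i : Fin n, ∑ j : Fin n, φ (ε i ω) * φ (ε j ω) * inner ℝ (R i) (R j) := fun ω => by
    rw [← real_inner_self_eq_norm_sq, sum_inner]
    refine Finset.sum_congr rfl fun i _ => ?_
    rw [inner_sum]
    refine Finset.sum_congr rfl fun j _ => ?_
    rw [real_inner_smul_left, real_inner_smul_right]
    ring
  have hij : ∀ i j : Fin n, Integrable (fun ω => φ (ε i ω) * φ (ε j ω) * inner ℝ (R i) (R j)) P :=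
    fun i j => ((hL2 i).integrable_mul (hL2 j)).mul_const _
  have hint : Integrable (fun ω => ‖∑ k : Fin n, φ (ε k ω) • R k‖ ^ 2) P := by
    simp only [hexp]
    exact integrable_finsetSum _ fun i _ => integrable_finsetSum _ fun j _ => hij i j
  have hval : ∫ ω, ‖∑ k : Fin n, φ (ε k ω) • R k‖ ^ 2 ∂P =
      (∫ ω, φ (ε 0 ω) ^ 2 ∂P) * ∑ k : Fin n, ‖R k‖ ^ 2 := by
    simp only [hexp]
    rw [integral_finsetSum _ fun i _ => integrable_finsetSum _ fun j _ => hij i j,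
      Finset.mul_sum]
    refine Finset.sum_congr rfl fun i _ => ?_
    rw [integral_finsetSum _ fun j _ => hij i j, Finset.sum_eq_single i]
    · rw [integral_mul_const, real_inner_self_eq_norm_sq]
      congr 1
      have := ((hid i).comp (measurable_id.pow_const 2)).integral_eq
      simp only [Function.comp_def, id] at this
      rw [← this]
      simp only [sq]
    · intro j _ hji
      have hne : (i : ℕ) ≠ j := fun h => hji (Fin.ext h.symm)
      have hind := (hindep.indepFun hne).comp hφ hφ
      have h1 := hind.integral_fun_mul_eq_mul_integral
        (hφ.comp (hε i)).aestronglyMeasurable (hφ.comp (hε j)).aestronglyMeasurable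
      simp only [Function.comp_def] at h1
      rw [integral_mul_const, h1, (hid i).integral_eq, hmean]
      simp
    · simp
  have hmarkov := mul_meas_ge_le_integral_of_nonneg
    (Eventually.of_forall fun ω => sq_nonneg ‖∑ k : Fin n, φ (ε k ω) • R k‖) hint τ
  calc P {ω | τ < ‖∑ k : Fin n, φ (ε k ω) • R k‖ ^ 2} ≤ P {ω | τ ≤ ‖∑ k : Fin n, φ (ε k ω) • R k‖ ^ 2} :=
        measure_mono <| ofPred_subset_ofPred.2 fun ω hω => hω.le
    _ = ENNReal.ofReal (P.real {ω | τ ≤ ‖∑ k : Fin n, φ (ε k ω) • R k‖ ^ 2}) := by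
      rw [ofReal_measureReal]
    _ ≤ _ := by
      apply ENNReal.ofReal_le_ofReal
      rw [le_div_iff₀ hτ, ← hval]
      linarith

end Probability

/-! ### Evaluation functionals in the Hilbert space of the penalized norm -/

/-- The Hilbert space `L²([0,1]) × L²([0,1])`, which contains `W^{m,2}([0,1])` isometrically. -/
abbrev PairSpace : Type := WithLp 2 (Lp ℝ 2 unitMeasure × Lp ℝ 2 unitMeasure)

/-- The embedding `f ↦ (f, √lam f^{(m)})`, isometric for the norm `‖·‖_{m,lam}`. -/
noncomputable def embed (m : ℕ) (hm : 1 ≤ m) (lam : ℝ) : sobolev m hm →ₗ[ℝ] PairSpace :=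
  (WithLp.linearEquiv 2 ℝ (Lp ℝ 2 unitMeasure × Lp ℝ 2 unitMeasure)).symm.toLinearMap ∘ₗ
    (inclL2 m hm).prod (√lam • topDeriv m hm)

lemma norm_embed_sq {m : ℕ} (hm : 1 ≤ m) {lam : ℝ} (hlam : 0 ≤ lam) (f : sobolev m hm) :
    ‖embed m hm lam f‖ ^ 2 = sobolevSq m lam f := by
  have h : ‖embed m hm lam f‖ ^ 2 = ‖inclL2 m hm f‖ ^ 2 + ‖√lam • topDeriv m hm f‖ ^ 2 :=
    WithLp.prod_norm_sq_eq_of_L2 (embed m hm lam f)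
  rw [h, norm_smul, mul_pow, Real.norm_eq_abs, sq_abs, Real.sq_sqrt hlam, sobolevSq,
    l2Sq_eq_norm_toLp (IsSobolev.memLp_self f.2), l2Sq_eq_norm_toLp (IsSobolev.memLp f.2)]
  rfl

/-- A uniform bound for the values gives representers of the evaluation functionals with the
corresponding norm bound. -/
lemma exists_eval_representer {m : ℕ} (hm : 1 ≤ m) {lam B : ℝ} (hlam : 0 ≤ lam) (hB : 0 ≤ B)
    {x : ℝ} (hx : ∀ f, IsSobolev m f → f x ^ 2 ≤ B * sobolevSq m lam f) :
    ∃ R : PairSpace, ‖R‖ ^ 2 ≤ B ∧ ∀ f : sobolev m hm, inner ℝ R (embed m hm lam f) =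
      (f : ℝ → ℝ) x := by
  obtain ⟨R, hR, h⟩ := exists_representer (embed m hm lam) (evalPt m hm x) (Real.sqrt_nonneg B)
    fun f => by
      apply abs_le_of_sq_le_sq _ (by positivity)
      rw [mul_pow, Real.sq_sqrt hB, norm_embed_sq hm hlam]
      exact hx f f.2
  refine ⟨R, ?_, h⟩
  rw [← Real.sq_sqrt hB]
  exact pow_le_pow_left₀ (norm_nonneg _) hR 2

/-! ### Convexity and localization -/

lemma IsSobolev.sub {m : ℕ} (hm : 1 ≤ m) {f g : ℝ → ℝ} (hf : IsSobolev m f)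
    (hg : IsSobolev m g) : IsSobolev m (f - g) := by
  have := hf.add hm (hg.smul (-1))
  rwa [neg_one_smul, ← sub_eq_add_neg] at this

lemma sobolevSq_smul (m : ℕ) (lam c : ℝ) (f : ℝ → ℝ) :
    sobolevSq m lam (c • f) = c ^ 2 * sobolevSq m lam f := by
  have h : ∀ u : ℝ → ℝ, l2Sq (c • u) = c ^ 2 * l2Sq u := fun u => by
    rw [l2Sq_eq_setIntegral, l2Sq_eq_setIntegral, ← integral_const_mul]
    simp [mul_pow]
  rw [sobolevSq, sobolevSq, D_smul, h, h]
  ring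

lemma sqrt_l2Sq_D {m : ℕ} (hm : 1 ≤ m) (f : sobolev m hm) :
    √(l2Sq (D m f)) = ‖topDeriv m hm f‖ := by
  rw [l2Sq_eq_norm_toLp (IsSobolev.memLp f.2)]
  exact Real.sqrt_sq (norm_nonneg _)

lemma l2Sq_D_eq {m : ℕ} (hm : 1 ≤ m) (f : sobolev m hm) :
    l2Sq (D m f) = ‖topDeriv m hm f‖ ^ 2 :=
  l2Sq_eq_norm_toLp (IsSobolev.memLp f.2)

lemma objective_convex_le {m : ℕ} (hm : 1 ≤ m) {ρ : ℝ → ℝ} (hρ : ConvexOn ℝ univ ρ) {lam : ℝ}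
    (hlam : 0 ≤ lam) {n : ℕ} (t y : Fin n → ℝ) (s : ℝ) {f g : ℝ → ℝ} (hf : IsSobolev m f)
    (hg : IsSobolev m g) {θ : ℝ} (h0 : 0 ≤ θ) (h1 : θ ≤ 1) :
    objective m ρ lam t y s (f + θ • (g - f)) ≤
      (1 - θ) * objective m ρ lam t y s f + θ * objective m ρ lam t y s g := by
  have hρi : ∀ i, ρ ((y i - (f + θ • (g - f)) (t i)) / s) ≤
      (1 - θ) * ρ ((y i - f (t i)) / s) + θ * ρ ((y i - g (t i)) / s) := fun i => by
    have := hρ.2 (mem_univ ((y i - f (t i)) / s)) (mem_univ ((y i - g (t i)) / s))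
      (sub_nonneg.2 h1) h0 (by ring)
    simp only [smul_eq_mul] at this
    refine le_trans (le_of_eq ?_) this
    congr 1
    simp only [Pi.add_apply, Pi.smul_apply, Pi.sub_apply, smul_eq_mul]
    ring
  set F : sobolev m hm := ⟨f, hf⟩
  set G : sobolev m hm := ⟨g, hg⟩
  have hpen : l2Sq (D m (f + θ • (g - f))) ≤ (1 - θ) * l2Sq (D m f) + θ * l2Sq (D m g) := by
    change l2Sq (D m ((F + θ • (G - F) : sobolev m hm) : ℝ → ℝ)) ≤
      (1 - θ) * l2Sq (D m (F : ℝ → ℝ)) + θ * l2Sq (D m (G : ℝ → ℝ))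
    rw [l2Sq_D_eq, l2Sq_D_eq, l2Sq_D_eq]
    have hlin : topDeriv m hm (F + θ • (G - F)) =
        (1 - θ) • topDeriv m hm F + θ • topDeriv m hm G := by
      rw [map_add, map_smul, map_sub]
      module
    have hn : ‖topDeriv m hm (F + θ • (G - F))‖ ≤
        (1 - θ) * ‖topDeriv m hm F‖ + θ * ‖topDeriv m hm G‖ := by
      rw [hlin]
      refine (norm_add_le _ _).trans (le_of_eq ?_)
      rw [norm_smul, norm_smul, Real.norm_of_nonneg h0, Real.norm_of_nonneg (sub_nonneg.2 h1)]
    refine (pow_le_pow_left₀ (norm_nonneg _) hn 2).trans ?_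
    nlinarith [mul_nonneg (mul_nonneg h0 (sub_nonneg.2 h1))
      (sq_nonneg (‖topDeriv m hm F‖ - ‖topDeriv m hm G‖))]
  have hsum := Finset.sum_le_sum fun i (_ : i ∈ Finset.univ) => hρi i
  rw [Finset.sum_add_distrib, ← Finset.mul_sum, ← Finset.mul_sum] at hsum
  have hsum' := mul_le_mul_of_nonneg_left hsum (by positivity : (0 : ℝ) ≤ 1 / n)
  have hpen' := mul_le_mul_of_nonneg_left hpen hlam
  unfold objective
  linarith

/-- If the objective is larger on a sphere around `f₀` than at `f₀`, then its minimizers lie in the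
ball. -/
lemma IsSmoothingSpline.sobolevSq_sub_le {m : ℕ} (hm : 1 ≤ m) {ρ : ℝ → ℝ}
    (hρ : ConvexOn ℝ univ ρ) {lam : ℝ} (hlam : 0 ≤ lam) {n : ℕ} {t y : Fin n → ℝ} {s : ℝ}
    {f f₀ : ℝ → ℝ} (hf : IsSmoothingSpline m ρ lam t y s f) (hf₀ : IsSobolev m f₀) {r : ℝ}
    (hr : 0 < r) (hsphere : ∀ g, IsSobolev m g → sobolevSq m lam g = r ^ 2 →
      objective m ρ lam t y s f₀ < objective m ρ lam t y s (f₀ + g)) :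
    sobolevSq m lam (f - f₀) ≤ r ^ 2 := by
  by_contra! hcon
  set q := sobolevSq m lam (f - f₀)
  have hq : 0 < q := (pow_pos hr 2).trans hcon
  have hrq : r < √q := Real.lt_sqrt_of_sq_lt hcon
  set θ := r / √q
  have hθ0 : 0 ≤ θ := by positivity
  have hθ1 : θ ≤ 1 := (div_le_one (by positivity)).2 hrq.le
  have hsub := hf.1.sub hm hf₀
  have h1 := hsphere (θ • (f - f₀)) (hsub.smul θ) (by
    rw [sobolevSq_smul, div_pow, Real.sq_sqrt hq.le]
    exact div_mul_cancel₀ _ hq.ne')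
  have h2 := objective_convex_le hm hρ hlam t y s hf₀ hf.1 hθ0 hθ1
  have h3 := hf.2 f₀ hf₀
  nlinarith

/-! ### The objective on a sphere around the regression function -/

/-- The deterministic part of the argument: if the empirical quantities are under control for `g`
on a sphere of radius `r`, then the objective at `f₀ + g` exceeds that at `f₀`. Here `w` stands for
the mean excess loss, `Lam` bounds the linear term and `z` the effect of the estimated scale. -/
lemma objective_lt_of_sphere {m : ℕ} (hm : 1 ≤ m) {ρ ψ : ℝ → ℝ} (hρ : SmoothLoss ρ ψ)
    {lam s σ κ r θ Lam z M : ℝ} (hlam : 0 < lam) (hs : 0 < s) (hσ : 0 < σ) (hκ : 0 < κ)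
    (hr : 0 < r) (hs1 : σ / 2 ≤ s) (hs2 : s ≤ 2 * σ) {n : ℕ} (hn : 1 ≤ n) (t e : Fin n → ℝ)
    {f₀ g : ℝ → ℝ} (hf₀ : IsSobolev m f₀) (hg : IsSobolev m g)
    (hgr : sobolevSq m lam g = r ^ 2)
    (hM : ∀ x : ℝ, |ψ (1 / s * x) - ψ (1 / σ * x)| ≤ M * |1 / s - 1 / σ|)
    (hz : M * |1 / s - 1 / σ| ≤ z)
    (hemp : |1 / (n : ℝ) * ∑ i, g (t i) ^ 2 - l2Sq g| ≤ θ * r ^ 2) (hθ1 : θ ≤ 1)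
    (hθ : κ * θ ≤ min κ (σ / 2) / 4) {w : ℝ → ℝ} (hw : ∀ i, κ * g (t i) ^ 2 ≤ w (g (t i)))
    (hdev : ∑ i, (w (g (t i)) - excess ρ ψ σ (e i) (g (t i))) ≤
      n * (min κ (σ / 2) / 4 * r ^ 2))
    (hlin : ∑ i, ψ (e i / σ) * g (t i) ≤ n * (Lam * r))
    (hbig : Lam + 2 * z + 4 * σ * √(l2Sq (D m f₀)) * √lam < min κ (σ / 2) / 4 * r) :
    objective m ρ lam t (fun i => f₀ (t i) + e i) s f₀ <
      objective m ρ lam t (fun i => f₀ (t i) + e i) s (f₀ + g) := by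
  set c := min κ (σ / 2) with hc
  have hn0 : (0 : ℝ) < n := by exact_mod_cast hn
  have hz0 : 0 ≤ z := ((abs_nonneg _).trans (hM 0)).trans hz
  set F : sobolev m hm := ⟨f₀, hf₀⟩
  set G : sobolev m hm := ⟨g, hg⟩
  set A := l2Sq g
  set E := l2Sq (D m g) with hE
  have hA0 : 0 ≤ A := l2Sq_nonneg _
  have hE0 : 0 ≤ E := l2Sq_nonneg _
  have hAE : A + lam * E = r ^ 2 := hgr
  -- the penalty
  have hpen : l2Sq (D m f₀) - 2 * √(l2Sq (D m f₀)) * √E + E ≤ l2Sq (D m (f₀ + g)) := by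
    change l2Sq (D m (F : ℝ → ℝ)) - 2 * √(l2Sq (D m (F : ℝ → ℝ))) * √(l2Sq (D m (G : ℝ → ℝ))) +
      l2Sq (D m (G : ℝ → ℝ)) ≤ l2Sq (D m ((F + G : sobolev m hm) : ℝ → ℝ))
    rw [sqrt_l2Sq_D, sqrt_l2Sq_D, l2Sq_D_eq, l2Sq_D_eq, l2Sq_D_eq, map_add,
      norm_add_sq_real]
    have := (abs_le.1 (abs_real_inner_le_norm (topDeriv m hm F) (topDeriv m hm G))).1
    linarith
  have hlE : √lam * √E ≤ r := by
    rw [← Real.sqrt_mul hlam.le, ← Real.sqrt_sq hr.le]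
    exact Real.sqrt_le_sqrt (by linarith)
  -- the empirical norm
  have hemp' := abs_le.1 hemp
  have hA1 : A ≤ r ^ 2 := by nlinarith
  have hsq : 1 / (n : ℝ) * ∑ i, g (t i) ^ 2 ≤ 2 * r ^ 2 := by
    nlinarith [hemp'.2, mul_le_mul_of_nonneg_right hθ1 (sq_nonneg r)]
  have habs : ∑ i, |g (t i)| ≤ n * (2 * r) := by
    have h1 := sq_sum_le_card_mul_sum_sq (s := Finset.univ) (f := fun i => |g (t i)|)
    simp only [sq_abs, Finset.card_univ, Fintype.card_fin] at h1
    have h2 : ∑ i, g (t i) ^ 2 ≤ n * (2 * r ^ 2) := by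
      rw [one_div, ← div_eq_inv_mul, div_le_iff₀ hn0] at hsq
      linarith
    apply le_of_sq_le_sq _ (by positivity)
    calc (∑ i, |g (t i)|) ^ 2 ≤ n * ∑ i, g (t i) ^ 2 := h1
      _ ≤ n * (n * (2 * r ^ 2)) := by gcongr
      _ ≤ (n * (2 * r)) ^ 2 := by nlinarith [mul_pos hn0 hn0, sq_nonneg (n * r)]
  -- the data part
  have hloss : ∀ i, (excess ρ ψ σ (e i) (g (t i)) - ψ (e i / σ) * g (t i)) - z * |g (t i)| ≤
      s * (ρ ((e i - g (t i)) / s) - ρ (e i / s)) := fun i => by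
    have h1 := (abs_le.1 (hρ.abs_scale_change_le hs hσ hM (e i) (g (t i)))).1
    have h2 := mul_le_mul_of_nonneg_right hz (abs_nonneg (g (t i)))
    unfold excess
    linarith
  have hsum := Finset.sum_le_sum fun i (_ : i ∈ Finset.univ) => hloss i
  rw [Finset.sum_sub_distrib, Finset.sum_sub_distrib, ← Finset.mul_sum, ← Finset.mul_sum,
    Finset.sum_sub_distrib] at hsum
  rw [Finset.sum_sub_distrib] at hdev
  have hwsum : κ * (A - θ * r ^ 2) * n ≤ ∑ i, w (g (t i)) := by
    have h1 : κ * ∑ i, g (t i) ^ 2 ≤ ∑ i, w (g (t i)) := by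
      rw [Finset.mul_sum]
      exact Finset.sum_le_sum fun i _ => hw i
    have h2 : (A - θ * r ^ 2) * n ≤ ∑ i, g (t i) ^ 2 := by
      have := hemp'.1
      rw [one_div, ← div_eq_inv_mul] at this
      rw [← le_div_iff₀ hn0]
      linarith
    calc κ * (A - θ * r ^ 2) * n = κ * ((A - θ * r ^ 2) * n) := by ring
      _ ≤ κ * ∑ i, g (t i) ^ 2 := by gcongr
      _ ≤ _ := h1
  set Q := ∑ i, ρ ((e i - g (t i)) / s) - ∑ i, ρ (e i / s) with hQ
  have hzabs := mul_le_mul_of_nonneg_left habs hz0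
  have hdata : n * (κ * (A - θ * r ^ 2) - c / 4 * r ^ 2 - Lam * r - 2 * z * r) ≤ s * Q := by
    linarith
  have hdiff : s * (objective m ρ lam t (fun i => f₀ (t i) + e i) s (f₀ + g) -
      objective m ρ lam t (fun i => f₀ (t i) + e i) s f₀) =
      1 / n * (s * Q) + s * lam * (l2Sq (D m (f₀ + g)) - l2Sq (D m f₀)) := by
    have e1 : ∀ i, f₀ (t i) + e i - (f₀ + g) (t i) = e i - g (t i) := fun i => by
      simp only [Pi.add_apply]; ring
    have e2 : ∀ i, f₀ (t i) + e i - f₀ (t i) = e i := fun i => by ring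
    simp only [objective, e1, e2, hQ]
    ring
  have hdata' : κ * (A - θ * r ^ 2) - c / 4 * r ^ 2 - Lam * r - 2 * z * r ≤ 1 / n * (s * Q) := by
    rw [one_div, ← div_eq_inv_mul, le_div_iff₀ hn0]
    linarith
  have hpen' : σ / 2 * (lam * E) - 4 * σ * √(l2Sq (D m f₀)) * √lam * r ≤
      s * lam * (l2Sq (D m (f₀ + g)) - l2Sq (D m f₀)) := by
    have h1 : s * lam * (E - 2 * √(l2Sq (D m f₀)) * √E) ≤
        s * lam * (l2Sq (D m (f₀ + g)) - l2Sq (D m f₀)) :=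
      mul_le_mul_of_nonneg_left (by linarith) (by positivity)
    have h2 : σ / 2 * (lam * E) ≤ s * (lam * E) :=
      mul_le_mul_of_nonneg_right hs1 (by positivity)
    have h3 : s * lam * (2 * √(l2Sq (D m f₀)) * √E) ≤
        4 * σ * √(l2Sq (D m f₀)) * √lam * r := by
      calc s * lam * (2 * √(l2Sq (D m f₀)) * √E)
          = 2 * s * √(l2Sq (D m f₀)) * √lam * (√lam * √E) := by
            nth_rewrite 1 [← Real.mul_self_sqrt hlam.le]
            ring
        _ ≤ 2 * (2 * σ) * √(l2Sq (D m f₀)) * √lam * r := by gcongr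
        _ = _ := by ring
    linarith
  have hcA : c * r ^ 2 ≤ κ * A + σ / 2 * (lam * E) := by
    rw [← hAE, mul_add]
    exact add_le_add (mul_le_mul_of_nonneg_right (min_le_left _ _) hA0)
      (mul_le_mul_of_nonneg_right (min_le_right _ _) (by positivity))
  have hc0 : 0 < c := lt_min hκ (half_pos hσ)
  have hfin : 0 < s * (objective m ρ lam t (fun i => f₀ (t i) + e i) s (f₀ + g) -
      objective m ρ lam t (fun i => f₀ (t i) + e i) s f₀) := by
    rw [hdiff]
    have h1 := mul_lt_mul_of_pos_right hbig hr
    have h2 := mul_le_mul_of_nonneg_right hθ (sq_nonneg r)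
    have h3 := mul_pos hc0 (pow_pos hr 2)
    linarith
  have := (mul_pos_iff_of_pos_left hs).1 hfin
  linarith

/-! ### The smoothing parameter -/

lemma tendsto_zero_of_rate {lam : ℕ → ℝ} {γ : ℝ} (hγ0 : 0 < γ)
    (hrate : lam =Θ[atTop] fun n : ℕ => (n : ℝ) ^ (-γ)) : Tendsto lam atTop (𝓝 0) :=
  hrate.1.trans_tendsto ((tendsto_rpow_neg_atTop hγ0).comp tendsto_natCast_atTop_atTop)

lemma tendsto_inv_mul_of_rate {lam : ℕ → ℝ} {γ : ℝ} (hγ1 : γ < 1)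
    (hrate : lam =Θ[atTop] fun n : ℕ => (n : ℝ) ^ (-γ)) :
    Tendsto (fun n : ℕ => ((n : ℝ) * lam n)⁻¹) atTop (𝓝 0) := by
  have h1 : (fun n : ℕ => ((n : ℝ) * lam n)⁻¹) =O[atTop]
      fun n : ℕ => ((n : ℝ) * (n : ℝ) ^ (-γ))⁻¹ := by
    refine IsBigO.inv_rev ((isBigO_refl _ _).mul hrate.2) ?_
    filter_upwards [eventually_ge_atTop 1] with n hn h0
    have hn0 : (0 : ℝ) < n := by exact_mod_cast hn
    have : (0 : ℝ) < (n : ℝ) * (n : ℝ) ^ (-γ) := by positivity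
    exact absurd h0 this.ne'
  refine h1.trans_tendsto ?_
  have h2 : Tendsto (fun n : ℕ => (n : ℝ) ^ (-(1 - γ))) atTop (𝓝 0) :=
    (tendsto_rpow_neg_atTop (by linarith)).comp tendsto_natCast_atTop_atTop
  refine h2.congr' ?_
  filter_upwards [eventually_ge_atTop 1] with n hn
  have hn0 : (0 : ℝ) < n := by exact_mod_cast hn
  nth_rewrite 2 [← Real.rpow_one (n : ℝ)]
  rw [← Real.rpow_add hn0, Real.rpow_neg hn0.le]
  rfl

/-- Elementary bounds for `h = lam ^ (1/(2m))`. -/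
lemma sqrt_le_rpow {m : ℕ} (hm : 1 ≤ m) {lam : ℝ} (hlam : 0 < lam) (h1 : lam ≤ 1) :
    √lam ≤ lam ^ (1 / (2 * (m : ℝ))) ∧ lam ^ (1 / (2 * (m : ℝ))) ≤ 1 := by
  have hm' : (1 : ℝ) ≤ m := by exact_mod_cast hm
  constructor
  · rw [Real.sqrt_eq_rpow]
    apply Real.rpow_le_rpow_of_exponent_ge hlam h1
    rw [div_le_div_iff₀ (by positivity) (by positivity)]
    linarith
  · exact Real.rpow_le_one hlam.le h1 (by positivity)

/-! ### The probability that the objective is small on a sphere -/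

/-- The deviation of the excess loss from its mean, uniformly over a ball of `W^{m,2}([0,1])`. -/
lemma measure_exists_excess_deviation_le {Ω : Type*} [MeasurableSpace Ω] {P : Measure Ω}
    [IsProbabilityMeasure P] {ε : ℕ → Ω → ℝ} (hε : ∀ i, Measurable (ε i))
    (hindep : iIndepFun ε P) (hident : ∀ i, IdentDistrib (ε i) (ε 0) P P) {m : ℕ} (hm : 1 ≤ m)
    {ρ ψ : ℝ → ℝ} (hρ : SmoothLoss ρ ψ) {K : NNReal} (hK : LipschitzWith K ψ) {σ lam B : ℝ}
    (hσ : 0 < σ) (hlam : 0 ≤ lam) (hB : 0 ≤ B) {n : ℕ} {t : Fin n → ℝ}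
    (hsup : ∀ k, ∀ f, IsSobolev m f → f (t k) ^ 2 ≤ B * sobolevSq m lam f) {r τ : ℝ}
    (hr : 0 ≤ r) (hτ : 0 < τ) :
    P {ω | ∃ g, IsSobolev m g ∧ sobolevSq m lam g ≤ r ^ 2 ∧
        τ < ∑ k : Fin n, ((∫ ω', excess ρ ψ σ (ε 0 ω') (g (t k)) ∂P) -
          excess ρ ψ σ (ε k ω) (g (t k)))} ≤
      ENNReal.ofReal (8 * (K / σ) * r ^ 2 * (B * √n) / τ) := by
  choose R hR hRf using fun k => exists_eval_representer hm hlam hB (hsup k)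
  set a := √B * r with ha
  have ha0 : 0 ≤ a := by positivity
  set w : ℝ → ℝ := fun h => ∫ ω', excess ρ ψ σ (ε 0 ω') h ∂P with hw
  have hbd : ∀ e h, |h| ≤ a → |excess ρ ψ σ e h| ≤ K / σ * a * a := fun e h hh => by
    have h1 := hρ.abs_excess_sub_le hK hσ (a := a) e hh (h' := 0) (by simpa using ha0)
    rw [SmoothLoss.excess_zero, sub_zero, sub_zero] at h1
    exact h1.trans (by gcongr)
  have hmeasE : ∀ h, Measurable fun e => excess ρ ψ σ e h := fun h =>
    (hρ.continuous_excess σ h).measurable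
  have hint : ∀ h, |h| ≤ a → Integrable (fun ω => excess ρ ψ σ (ε 0 ω) h) P := fun h hh =>
    Integrable.of_bound ((hmeasE h).comp (hε 0)).aestronglyMeasurable (K / σ * a * a)
      (Eventually.of_forall fun ω => hbd _ h hh)
  have hwbd : ∀ h, |h| ≤ a → |w h| ≤ K / σ * a * a := fun h hh => by
    have := norm_integral_le_of_norm_le_const (μ := P) (f := fun ω => excess ρ ψ σ (ε 0 ω) h)
      (Eventually.of_forall fun ω => hbd (ε 0 ω) h hh)
    simpa using this
  have hwlip : ∀ h h', |h| ≤ a → |h'| ≤ a → |w h - w h'| ≤ K / σ * a * |h - h'| :=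
    fun h h' hh hh' => by
      rw [hw]
      simp only
      rw [← integral_sub (hint h hh) (hint h' hh')]
      have := norm_integral_le_of_norm_le_const (μ := P)
        (f := fun ω => excess ρ ψ σ (ε 0 ω) h - excess ρ ψ σ (ε 0 ω) h')
        (Eventually.of_forall fun ω => hρ.abs_excess_sub_le hK hσ (ε 0 ω) hh hh')
      simpa using this
  let A := {g : sobolev m hm // sobolevSq m lam (g : ℝ → ℝ) ≤ r ^ 2}
  let x : A → PairSpace := fun g => embed m hm lam g.1
  have hxr : ∀ g : A, ‖x g‖ ≤ r := fun g => by
    apply le_of_sq_le_sq _ hr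
    rw [norm_embed_sq hm hlam]
    exact g.2
  let g₀ : A := ⟨0, by
    have h0 := norm_embed_sq hm hlam (0 : sobolev m hm)
    rw [map_zero, norm_zero, zero_pow two_ne_zero] at h0
    rw [← h0]
    positivity⟩
  have hRa : ∀ k (g : A), |inner ℝ (R k) (x g)| ≤ a := fun k g => by
    refine (abs_real_inner_le_norm _ _).trans ?_
    rw [ha]
    gcongr
    · exact Real.le_sqrt_of_sq_le (hR k)
    · exact hxr g
  have hmain := measure_exists_sum_gt_le hε hindep hident (x := x) (g₀ := g₀) (map_zero _)
    (r := r) (a := a) (b := K / σ * a * a + K / σ * a * a) (L := 2 * (K / σ * a)) ha0 hxr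
    (by positivity) (d := fun e h => w h - excess ρ ψ σ e h)
    (fun e => by simp [hw]) (fun h => measurable_const.sub (hmeasE h))
    (fun e h hh => (abs_sub _ _).trans (add_le_add (hwbd h hh) (hbd e h hh)))
    (fun e h h' hh hh' => by
      have h1 := hwlip h h' hh hh'
      have h2 := hρ.abs_excess_sub_le hK hσ e hh hh'
      rw [sub_sub_sub_comm]
      exact (abs_sub _ _).trans (by linarith))
    (fun h hh => by
      rw [integral_sub (integrable_const _) (hint h hh)]
      simp [hw])
    n R hRa hτ
  refine (measure_mono ?_).trans (hmain.trans (ENNReal.ofReal_le_ofReal ?_))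
  · refine ofPred_subset_ofPred.2 ?_
    rintro ω ⟨g, hg, hgr, hgτ⟩
    refine ⟨⟨⟨g, hg⟩, hgr⟩, ?_⟩
    simp only [x, hRf]
    exact hgτ
  · refine div_le_div_of_nonneg_right ?_ hτ.le
    have h1 : √(∑ k, ‖R k‖ ^ 2) ≤ √n * √B := by
      rw [← Real.sqrt_mul (Nat.cast_nonneg n)]
      apply Real.sqrt_le_sqrt
      refine (Finset.sum_le_sum fun k _ => hR k).trans (le_of_eq ?_)
      simp
    calc r * (4 * (2 * (K / σ * a)) * √(∑ k, ‖R k‖ ^ 2))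
        ≤ r * (4 * (2 * (K / σ * a)) * (√n * √B)) := by gcongr
      _ = 8 * (K / σ) * r ^ 2 * (√B * √B * √n) := by rw [ha]; ring
      _ = _ := by rw [Real.mul_self_sqrt hB]

/-- The linear term, uniformly over `W^{m,2}([0,1])`. -/
lemma measure_exists_linear_gt_le {Ω : Type*} [MeasurableSpace Ω] {P : Measure Ω}
    [IsProbabilityMeasure P] {ε : ℕ → Ω → ℝ} (hε : ∀ i, Measurable (ε i))
    (hindep : iIndepFun ε P) (hident : ∀ i, IdentDistrib (ε i) (ε 0) P P) {m : ℕ} (hm : 1 ≤ m)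
    {φ : ℝ → ℝ} (hφ : Measurable φ) (hsq : Integrable (fun ω => φ (ε 0 ω) ^ 2) P)
    (hmean : ∫ ω, φ (ε 0 ω) ∂P = 0) {lam B : ℝ} (hlam : 0 ≤ lam) (hB : 0 ≤ B) {n : ℕ}
    {t : Fin n → ℝ} (hsup : ∀ k, ∀ f, IsSobolev m f → f (t k) ^ 2 ≤ B * sobolevSq m lam f)
    {τ : ℝ} (hτ : 0 < τ) :
    P {ω | ∃ g, IsSobolev m g ∧
        τ * √(sobolevSq m lam g) < ∑ k : Fin n, φ (ε k ω) * g (t k)} ≤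
      ENNReal.ofReal ((∫ ω, φ (ε 0 ω) ^ 2 ∂P) * (n * B) / τ ^ 2) := by
  choose R hR hRf using fun k => exists_eval_representer hm hlam hB (hsup k)
  have hmain := measure_norm_sum_smul_gt_le hε hindep hident hφ hsq hmean n R (pow_pos hτ 2)
  refine (measure_mono ?_).trans (hmain.trans (ENNReal.ofReal_le_ofReal ?_))
  · refine ofPred_subset_ofPred.2 ?_
    rintro ω ⟨g, hg, hgτ⟩
    have h1 : ∑ k : Fin n, φ (ε k ω) * g (t k) =
        inner ℝ (∑ k : Fin n, φ (ε k ω) • R k) (embed m hm lam ⟨g, hg⟩) := by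
      rw [sum_inner]
      refine Finset.sum_congr rfl fun k _ => ?_
      rw [real_inner_smul_left, hRf]
    have h2 : √(sobolevSq m lam g) = ‖embed m hm lam ⟨g, hg⟩‖ := by
      rw [← norm_embed_sq hm hlam ⟨g, hg⟩]
      exact Real.sqrt_sq (norm_nonneg _)
    rw [h1, h2] at hgτ
    have h3 := hgτ.trans_le (real_inner_le_norm _ _)
    have h4 := lt_of_mul_lt_mul_right h3 (norm_nonneg _)
    exact pow_lt_pow_left₀ h4 hτ.le two_ne_zero
  · have : 0 ≤ ∫ ω, φ (ε 0 ω) ^ 2 ∂P := integral_nonneg fun ω => sq_nonneg _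
    gcongr
    refine (Finset.sum_le_sum fun k _ => hR k).trans (le_of_eq ?_)
    simp

/-! ### The rate of convergence -/

/-- The probability that a smoothing spline is farther than `r` from the regression function, for a
fixed sample size: it is bounded by the probabilities that the scale estimate, the excess loss and
the linear term are not under control. -/
lemma measure_sobolevSq_gt_le {Ω : Type*} [MeasurableSpace Ω] {P : Measure Ω}
    [IsProbabilityMeasure P] {ε : ℕ → Ω → ℝ} (hε : ∀ i, Measurable (ε i))
    (hindep : iIndepFun ε P) (hident : ∀ i, IdentDistrib (ε i) (ε 0) P P) {m : ℕ} (hm : 1 ≤ m)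
    {ρ ψ : ℝ → ℝ} (hρ : SmoothLoss ρ ψ) {K : NNReal} (hK : LipschitzWith K ψ)
    {σ lam B κ a₀ M θ r Lam z δ : ℝ} (hσ : 0 < σ) (hlam : 0 < lam) (hB : 0 ≤ B) (hκ : 0 < κ)
    (hr : 0 < r) (hLam : 0 < Lam) (hM0 : 0 ≤ M)
    (hM : ∀ u v x : ℝ, 1 / (3 * σ) < u → 1 / (3 * σ) < v → |ψ (u * x) - ψ (v * x)| ≤ M * |u - v|)
    (hsq : Integrable (fun ω => ψ (ε 0 ω / σ) ^ 2) P) (hmean : ∫ ω, ψ (ε 0 ω / σ) ∂P = 0)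
    (hexc : ∀ h : ℝ, |h| ≤ a₀ → κ * h ^ 2 ≤ ∫ ω, excess ρ ψ σ (ε 0 ω) h ∂P)
    {n : ℕ} (hn : 1 ≤ n) {t : Fin n → ℝ}
    (hsup : ∀ k, ∀ f, IsSobolev m f → f (t k) ^ 2 ≤ B * sobolevSq m lam f)
    (hemp : ∀ g, IsSobolev m g →
      |1 / (n : ℝ) * ∑ i, g (t i) ^ 2 - l2Sq g| ≤ θ * sobolevSq m lam g) (hθ1 : θ ≤ 1)
    (hθ : κ * θ ≤ min κ (σ / 2) / 4) (hBr : √B * r ≤ a₀) (hδ : δ ≤ σ / 2)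
    (hz : M * (2 * δ / σ ^ 2) ≤ z) {fo : ℝ → ℝ} (hfo : IsSobolev m fo)
    (hbig : Lam + 2 * z + 4 * σ * √(l2Sq (D m fo)) * √lam < min κ (σ / 2) / 4 * r)
    {fhat : Ω → ℝ → ℝ} {shat : Ω → ℝ} (hfhat : ∀ ω, 0 < shat ω →
      IsSmoothingSpline m ρ lam t (fun i => fo (t i) + ε i ω) (shat ω) (fhat ω)) :
    P {ω | r ^ 2 < sobolevSq m lam (fhat ω - fo)} ≤
      P {ω | δ < |shat ω - σ|} +
      ENNReal.ofReal (8 * (K / σ) * r ^ 2 * (B * √n) / (n * (min κ (σ / 2) / 4 * r ^ 2))) +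
      ENNReal.ofReal ((∫ ω, ψ (ε 0 ω / σ) ^ 2 ∂P) * (n * B) / (n * Lam) ^ 2) := by
  have hn0 : (0 : ℝ) < n := by exact_mod_cast hn
  have hc0 : 0 < min κ (σ / 2) := lt_min hκ (half_pos hσ)
  set c := min κ (σ / 2)
  have hE2 := measure_exists_excess_deviation_le hε hindep hident hm hρ hK hσ hlam.le hB hsup hr.le
    (by positivity : 0 < n * (c / 4 * r ^ 2))
  have hE3 := measure_exists_linear_gt_le hε hindep hident hm (φ := fun e => ψ (e / σ))
    (hρ.continuous_score.measurable.comp (measurable_id.div_const σ)) hsq hmean hlam.le hB hsup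
    (by positivity : 0 < n * Lam)
  refine le_trans ?_ (add_le_add (add_le_add_right hE2 _) hE3)
  refine le_trans (measure_mono ?_) ((measure_union_le _ _).trans
    (add_le_add_left (measure_union_le _ _) _))
  intro ω hω
  rw [mem_ofPred_eq] at hω
  by_contra hcon
  simp only [mem_union, mem_ofPred_eq, not_or, not_exists, not_and, not_lt] at hcon
  obtain ⟨⟨h1, h2⟩, h3⟩ := hcon
  have habs := abs_le.1 h1
  have hs1 : σ / 2 ≤ shat ω := by linarith [habs.1]
  have hs2 : shat ω ≤ 2 * σ := by linarith [habs.2]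
  have hs0 : 0 < shat ω := by linarith
  have hinv : |1 / shat ω - 1 / σ| ≤ 2 * δ / σ ^ 2 := by
    rw [div_sub_div _ _ hs0.ne' hσ.ne', abs_div, one_mul, mul_one, abs_sub_comm,
      abs_of_pos (mul_pos hs0 hσ), div_le_div_iff₀ (mul_pos hs0 hσ) (by positivity)]
    have hδ0 : 0 ≤ δ := (abs_nonneg _).trans h1
    calc |shat ω - σ| * σ ^ 2 ≤ δ * σ ^ 2 := by gcongr
      _ = 2 * δ * (σ / 2 * σ) := by ring
      _ ≤ 2 * δ * (shat ω * σ) := by gcongr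
  have hrecip : ∀ s : ℝ, 0 < s → s ≤ 2 * σ → 1 / (3 * σ) < 1 / s := fun s h0 hs =>
    one_div_lt_one_div_of_lt h0 (by linarith)
  have hle := (hfhat ω hs0).sobolevSq_sub_le hm hρ.convex hlam.le hfo hr fun g hg hgr => by
    have hgi : ∀ i, |g (t i)| ≤ a₀ := fun i => by
      refine le_trans ?_ hBr
      apply abs_le_of_sq_le_sq _ (by positivity)
      rw [mul_pow, Real.sq_sqrt hB, ← hgr]
      exact hsup i g hg
    refine objective_lt_of_sphere hm hρ hlam hs0 hσ hκ hr hs1 hs2 hn t (fun i => ε i ω) hfo hg hgr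
      (fun x => hM _ _ x (hrecip _ hs0 hs2) (hrecip _ hσ (by linarith)))
      ((mul_le_mul_of_nonneg_left hinv hM0).trans hz) (by rw [← hgr]; exact hemp g hg) hθ1 hθ
      (w := fun h => ∫ ω', excess ρ ψ σ (ε 0 ω') h ∂P) (fun i => hexc _ (hgi i))
      (h2 g hg hgr.le) (Lam := Lam) ?_ hbig
    have := h3 g hg
    rwa [hgr, Real.sqrt_sq hr.le, mul_assoc] at this
  linarith

end MSpline

theorem theorem3 {Ω : Type*} [MeasurableSpace Ω] (P : Measure Ω) [IsProbabilityMeasure P]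
    -- smoothness order, regression function, design and i.i.d. errors
    (m : ℕ) (hm : 1 ≤ m)
    (fo : ℝ → ℝ) (hfo : MSpline.IsSobolev m fo)
    (t : ∀ n : ℕ, Fin n → ℝ) (ht : ∀ n i, t n i ∈ Icc (0 : ℝ) 1)
    (ε : ℕ → Ω → ℝ) (hε : ∀ i, Measurable (ε i)) (hindep : iIndepFun ε P)
    (hident : ∀ i, IdentDistrib (ε i) (ε 0) P P)
    -- loss and score
    (ρ ψ : ℝ → ℝ) (hρ : MSpline.SmoothLoss ρ ψ)
    (σ : ℝ) (hσ : 0 < σ) (hψ : MSpline.ScoreLinearization P ψ (ε 0) σ)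
    -- design
    (hdesign : MSpline.QuasiUniform t)
    -- a small absolute moment of the errors
    (hmoment : ∃ c : ℝ, 0 < c ∧ Integrable (fun ω => |ε 0 ω| ^ c) P)
    -- auxiliary scale
    (σhat : ℕ → Ω → ℝ) (hσhat : ∀ n, Measurable (σhat n))
    (hscale : MSpline.IsBigOP P (fun n ω => √(n : ℝ) * (σhat n ω - σ)) (fun _ => 1))
    -- smoothing parameters
    (lam : ℕ → ℝ) (hlam : ∀ n, 0 < lam n)
    (γ : ℝ) (hγ0 : 0 < γ) (hγ1 : γ < 1)
    (hrate : lam =Θ[atTop] fun n : ℕ => (n : ℝ) ^ (-γ)) :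
    ∃ fhat : ∀ n : ℕ, (Fin n → ℝ) → ℝ → (ℝ → ℝ),
      (∀ n : ℕ, 1 ≤ n → ∀ (y : Fin n → ℝ) (s : ℝ), 0 < s →
        MSpline.IsSmoothingSpline m ρ (lam n) (t n) y s (fhat n y s)) ∧
      MSpline.IsBigOP P
        (fun n ω => MSpline.sobolevSq m (lam n)
          (fun x => fhat n (fun i => fo (t n i) + ε i ω) (σhat n ω) x - fo x))
        (fun n => lam n + ((n : ℝ) * lam n ^ (1 / (2 * (m : ℝ))))⁻¹) := by
  obtain ⟨⟨x₁, hx₁⟩, x₂, hx₂⟩ := hψ.exists_signs hσ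
  obtain ⟨cg, Cg, hcg, hgrowth⟩ := hρ.exists_linear_growth hx₁ hx₂
  choose! fhat hfhat using fun (n : ℕ) (hn : 1 ≤ n) (y : Fin n → ℝ) (s : ℝ) (hs : 0 < s) =>
    MSpline.exists_isSmoothingSpline hm hρ.continuous hcg hgrowth (hlam n) hn (t n) (ht n) y hs
  refine ⟨fhat, hfhat, fun η hη => ?_⟩
  -- constants that depend on the model only
  obtain ⟨K, hK⟩ := hρ.lipschitz
  obtain ⟨cm, hcm, hmom⟩ := hmoment
  have hsq := hρ.integrable_score_sq (hε 0) hcm hmom hσ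
  have hint : Integrable (fun ω => ψ (ε 0 ω / σ)) P :=
    ((memLp_two_iff_integrable_sq (hρ.continuous_score.measurable.comp
      ((hε 0).div_const σ)).aestronglyMeasurable).2 hsq).integrable one_le_two
  have hmean : ∫ ω, ψ (ε 0 ω / σ) ∂P = 0 := by
    obtain ⟨ξ, hξ, -⟩ := hψ
    exact (hξ σ hσ).1
  obtain ⟨κ, a₀, hκ, ha₀, hexc⟩ := hρ.exists_le_integral_excess (hε 0) hσ hψ hint
  obtain ⟨C₁, hC₁, hsup⟩ := MSpline.exists_sq_le_sobolevSq hm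
  obtain ⟨C₂, hC₂, hquasi⟩ := hdesign.exists_abs_sub_le hm
  obtain ⟨M', hM'⟩ := hρ.slow (1 / (3 * σ)) (by positivity)
  set M := max M' 0 with hMdef
  have hM0 : 0 ≤ M := le_max_right _ _
  have hM : ∀ u v x : ℝ, 1 / (3 * σ) < u → 1 / (3 * σ) < v →
      |ψ (u * x) - ψ (v * x)| ≤ M * |u - v| := fun u v x hu hv =>
    (hM' u v x hu hv).trans (mul_le_mul_of_nonneg_right (le_max_left _ _) (abs_nonneg _))
  set c := min κ (σ / 2) with hc
  have hc0 : 0 < c := lt_min hκ (half_pos hσ)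
  set V := ∫ ω, ψ (ε 0 ω / σ) ^ 2 ∂P with hV
  have hV0 : 0 ≤ V := integral_nonneg fun ω => sq_nonneg _
  -- constants that depend on the prescribed probability
  obtain ⟨B₁, hB₁⟩ := hscale (η / 3) (by positivity)
  set B₀ := max B₁ 0 with hB₀
  have hB₀0 : 0 ≤ B₀ := le_max_right _ _
  set L₀ := √(3 * V * C₁ / η + 1) with hL₀
  have hL₀0 : 0 < L₀ := Real.sqrt_pos.2 (by positivity)
  set F := √(MSpline.l2Sq (MSpline.D m fo)) with hF
  set Z₀ := M * (2 * B₀ / σ ^ 2) with hZ₀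
  have hZ₀0 : 0 ≤ Z₀ := by positivity
  set R := 4 / c * (L₀ + 2 * Z₀ + 4 * σ * F) + 1 with hR
  have hR0 : 0 < R := by positivity
  have hRbig : L₀ + 2 * Z₀ + 4 * σ * F < c / 4 * R := by
    have : c / 4 * R = L₀ + 2 * Z₀ + 4 * σ * F + c / 4 := by
      rw [hR]; field_simp
    linarith
  refine ⟨R ^ 2, ?_⟩
  -- the asymptotic conditions on the sample size
  have hlim0 := MSpline.tendsto_zero_of_rate hγ0 hrate
  have hlim1 := MSpline.tendsto_inv_mul_of_rate hγ1 hrate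
  have hlims : Tendsto (fun n => √(lam n)) atTop (𝓝 0) := by
    have := (Real.continuous_sqrt.tendsto 0).comp hlim0
    rwa [Real.sqrt_zero] at this
  have hlims1 : Tendsto (fun n : ℕ => √(((n : ℝ) * lam n)⁻¹)) atTop (𝓝 0) := by
    have := (Real.continuous_sqrt.tendsto 0).comp hlim1
    rwa [Real.sqrt_zero] at this
  have ev1 : ∀ᶠ n in atTop, lam n < (1 / 2) ^ (2 * m) :=
    hlim0.eventually_lt_const (by positivity)
  have ev2 : ∀ᶠ n : ℕ in atTop, C₂ * ((n : ℝ) * lam n)⁻¹ < min 1 (c / (4 * κ)) := by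
    have := hlim1.const_mul C₂
    rw [mul_zero] at this
    exact this.eventually_lt_const (lt_min one_pos (by positivity))
  have ev3 : ∀ᶠ n : ℕ in atTop, C₁ * R ^ 2 * (√(lam n) + ((n : ℝ) * lam n)⁻¹) < a₀ ^ 2 := by
    have := (hlims.add hlim1).const_mul (C₁ * R ^ 2)
    rw [add_zero, mul_zero] at this
    exact this.eventually_lt_const (by positivity)
  have ev4 : ∀ᶠ n : ℕ in atTop, 32 * (K / σ) / c * C₁ * √(((n : ℝ) * lam n)⁻¹) < η / 3 := by
    have := hlims1.const_mul (32 * (K / σ) / c * C₁)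
    rw [mul_zero] at this
    exact this.eventually_lt_const (by positivity)
  have ev5 : ∀ᶠ n : ℕ in atTop, B₀ / √(n : ℝ) < σ / 2 := by
    have : Tendsto (fun n : ℕ => B₀ / √(n : ℝ)) atTop (𝓝 0) :=
      tendsto_const_nhds.div_atTop (Real.tendsto_sqrt_atTop.comp tendsto_natCast_atTop_atTop)
    exact this.eventually_lt_const (by positivity)
  filter_upwards [ev1, ev2, ev3, ev4, ev5, hB₁, eventually_ge_atTop 2] with n h1 h2 h3 h4 h5 h6 hn
  have hn0 : (0 : ℝ) < n := by exact_mod_cast (by omega : 0 < n)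
  have hl0 := hlam n
  have hl1 : lam n ≤ 1 := h1.le.trans (pow_le_one₀ (by norm_num) (by norm_num))
  set l := lam n with hl
  set h := l ^ (1 / (2 * (m : ℝ))) with hh
  have hh0 : 0 < h := Real.rpow_pos_of_pos hl0 _
  obtain ⟨hhs, hh1⟩ := MSpline.sqrt_le_rpow hm hl0 hl1
  rw [← hh] at hhs hh1
  have hsl0 : 0 < √l := Real.sqrt_pos.2 hl0
  have hsn0 : 0 < √(n : ℝ) := Real.sqrt_pos.2 hn0
  set a := l + ((n : ℝ) * h)⁻¹ with ha
  have hnh0 : 0 < ((n : ℝ) * h)⁻¹ := by positivity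
  have ha0 : 0 < a := by positivity
  set B := C₁ * h⁻¹ with hB
  have hB0 : 0 < B := by positivity
  have hla : √l ≤ √a := Real.sqrt_le_sqrt (by linarith)
  have hna : 1 / √(n : ℝ) ≤ √a := by
    rw [one_div, ← Real.sqrt_inv]
    apply Real.sqrt_le_sqrt
    have : (n : ℝ)⁻¹ ≤ ((n : ℝ) * h)⁻¹ :=
      inv_anti₀ (by positivity) (mul_le_of_le_one_right hn0.le hh1)
    linarith
  have hBn : B ≤ C₁ * (n * a) := by
    have : n * ((n : ℝ) * h)⁻¹ = h⁻¹ := by field_simp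
    rw [hB, ha, mul_add, this]
    have : 0 ≤ n * l := by positivity
    gcongr
    linarith
  set r := R * √a with hr
  have hr0 : 0 < r := mul_pos hR0 (Real.sqrt_pos.2 ha0)
  have hrsq : r ^ 2 = R ^ 2 * a := by rw [hr, mul_pow, Real.sq_sqrt ha0.le]
  have hBr : √B * r ≤ a₀ := by
    apply le_of_sq_le_sq _ ha₀.le
    rw [mul_pow, Real.sq_sqrt hB0.le, hrsq]
    refine le_trans ?_ h3.le
    have e1 : h⁻¹ * l ≤ √l := by
      rw [inv_mul_le_iff₀ hh0]
      nth_rewrite 1 [← Real.mul_self_sqrt hl0.le]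
      gcongr
    have e2 : h⁻¹ * ((n : ℝ) * h)⁻¹ ≤ ((n : ℝ) * l)⁻¹ := by
      rw [← mul_inv]
      apply inv_anti₀ (by positivity)
      calc n * l = n * (√l * √l) := by rw [Real.mul_self_sqrt hl0.le]
        _ ≤ n * (h * h) := by gcongr
        _ = _ := by ring
    calc B * (R ^ 2 * a) = C₁ * R ^ 2 * (h⁻¹ * l + h⁻¹ * ((n : ℝ) * h)⁻¹) := by
          rw [hB, ha]; ring
      _ ≤ _ := by gcongr
  have hθκ : κ * (C₂ * ((n : ℝ) * l)⁻¹) ≤ c / 4 := by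
    have := (h2.trans_le (min_le_right _ _)).le
    rw [le_div_iff₀ (by positivity)] at this
    linarith
  have hmain := MSpline.measure_sobolevSq_gt_le hε hindep hident hm hρ hK hσ hl0 hB0.le hκ hr0
    (Lam := L₀ * √a) (z := Z₀ * √a) (δ := B₀ / √(n : ℝ)) (θ := C₂ * ((n : ℝ) * l)⁻¹)
    (mul_pos hL₀0 (Real.sqrt_pos.2 ha0)) hM0 hM hsq hmean hexc (by omega) (t := t n)
    (fun k f hf => hsup l hl0 h1.le f hf _ (ht n k))
    (fun g hg => by
      have := hquasi l hl0 h1.le n hn g hg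
      rwa [div_eq_mul_inv] at this)
    (h2.trans_le (min_le_left _ _)).le hθκ hBr h5.le
    (by
      calc M * (2 * (B₀ / √(n : ℝ)) / σ ^ 2) = Z₀ * (1 / √(n : ℝ)) := by rw [hZ₀]; ring
        _ ≤ Z₀ * √a := by gcongr)
    hfo
    (by
      calc L₀ * √a + 2 * (Z₀ * √a) + 4 * σ * F * √l ≤
          L₀ * √a + 2 * (Z₀ * √a) + 4 * σ * F * √a := by gcongr
        _ = (L₀ + 2 * Z₀ + 4 * σ * F) * √a := by ring
        _ < c / 4 * R * √a := mul_lt_mul_of_pos_right hRbig (Real.sqrt_pos.2 ha0)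
        _ = c / 4 * r := by rw [hr]; ring)
    (fhat := fun ω => fhat n (fun i => fo (t n i) + ε i ω) (σhat n ω)) (shat := σhat n)
    (fun ω hω => hfhat n (by omega) _ _ hω)
  have hP1 : P {ω | B₀ / √(n : ℝ) < |σhat n ω - σ|} ≤ ENNReal.ofReal (η / 3) := by
    refine (measure_mono (ofPred_subset_ofPred.2 fun ω hω => ?_)).trans h6
    rw [div_lt_iff₀ hsn0] at hω
    rw [abs_mul, abs_of_pos hsn0, mul_one, mul_comm]
    exact (le_max_left _ _).trans_lt hω
  have hP2 : 8 * (K / σ) * r ^ 2 * (B * √(n : ℝ)) / (n * (c / 4 * r ^ 2)) ≤ η / 3 := by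
    refine le_trans ?_ h4.le
    have e1 : 8 * (K / σ) * r ^ 2 * (B * √(n : ℝ)) / (n * (c / 4 * r ^ 2)) =
        32 * (K / σ) / c * C₁ * (h⁻¹ * (√(n : ℝ))⁻¹) := by
      have e2 : (√(n : ℝ))⁻¹ = √(n : ℝ) / n := by
        rw [Real.sqrt_div_self]
      rw [e2, hB]
      field_simp
      ring
    rw [e1, mul_inv, Real.sqrt_mul (by positivity), Real.sqrt_inv, Real.sqrt_inv,
      mul_comm (√(n : ℝ))⁻¹]
    gcongr
  have hP3 : V * (n * B) / (n * (L₀ * √a)) ^ 2 ≤ η / 3 := by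
    have e1 : (n * (L₀ * √a)) ^ 2 = n * (n * a) * (3 * V * C₁ / η + 1) := by
      rw [mul_pow, mul_pow, Real.sq_sqrt ha0.le, hL₀, Real.sq_sqrt (by positivity)]
      ring
    rw [e1, div_le_iff₀ (by positivity)]
    calc V * (n * B) ≤ V * (n * (C₁ * (n * a))) := by gcongr
      _ = η / 3 * (n * (n * a) * (3 * V * C₁ / η)) := by field_simp
      _ ≤ _ := by gcongr; linarith
  have hset : {ω | R ^ 2 * a < |MSpline.sobolevSq m l
      (fun x => fhat n (fun i => fo (t n i) + ε i ω) (σhat n ω) x - fo x)|} =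
      {ω | r ^ 2 < MSpline.sobolevSq m l
        (fhat n (fun i => fo (t n i) + ε i ω) (σhat n ω) - fo)} := by
    ext ω
    rw [mem_ofPred_eq, mem_ofPred_eq, abs_of_nonneg (MSpline.sobolevSq_nonneg m hl0.le _), hrsq]
    rfl
  rw [hset]
  calc _ ≤ _ := hmain
    _ ≤ ENNReal.ofReal (η / 3) + ENNReal.ofReal (η / 3) + ENNReal.ofReal (η / 3) :=
      add_le_add (add_le_add hP1 (ENNReal.ofReal_le_ofReal hP2)) (ENNReal.ofReal_le_ofReal hP3)
    _ = ENNReal.ofReal η := by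
      rw [← ENNReal.ofReal_add (by positivity) (by positivity),
        ← ENNReal.ofReal_add (by positivity) (by positivity)]
      congr 1
      ring
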